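/- Let $X$ be a complete metric space and let $p \ge 1$ be a real number. Definitions. A probability measure on $X$ is a Borel probability measure; it is Radon if $\mu(B)=\sup\{\mu(C) : C\subseteq B,\ C \text{ compact}\}$ for every Borel set $B$, and it has finite moment of order $p$ if $\int d(x_0,x)^p\,\mathrm{d}\mu(x)<\infty$ for some $x_0\in X$. Let $P_p(X)$ be the set of Radon probability measures on $X$ with finite moment of order $p$, equipped with the Wasserstein distance $$W_p(\mu,\nu)=\Big(\inf_\gamma \int d(x,y)^p\,\mathrm{d}\gamma(x,y)\Big)^{1/p},$$ where $\gamma$ runs over the couplings between $\mu$ and $\nu$, i.e. the Borel probability measures on the topological product $X\times X$ with marginals $\mu$ and $\nu$, and with the operations $\mu+_r\nu=r\mu+(1-r)\nu$ for $r\in[0,1]$. Let $\delta:X\to P_p(X)$ send $x$ to the Dirac measure at $x$. A barycentric algebra is a set $A$ with binary operations $+_r$ for $r\in[0,1]$ such that $x+_1y=x$, $x+_rx=x$, $x+_ry=y+_{1-r}x$, and $(x+_qy)+_rz=x+_{qr}\big(y+_{\frac{r-qr}{1-qr}}z\big)$ whenever $q<1$ and $r<1$; a map between barycentric algebras is affine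 if it preserves all the operations $+_r$. A Wasserstein algebra of order $p$ is a metric space $A$ that is also a barycentric algebra, whose operations $+_r:A\times A\to A$ are nonexpansive for the max metric on $A\times A$, and which satisfies $$d(x+_ry,\,x'+_ry')^p\le r\,d(x,x')^p+(1-r)\,d(y,y')^p$$ for all $r\in[0,1]$ and $x,x',y,y'\in A$. It is complete if its metric is complete. Theorem. $W_p$ is a (finite) metric on $P_p(X)$, and with this metric and the operations $+_r$, $P_p(X)$ is the free complete Wasserstein algebra of order $p$ over $X$, with universal arrow $\delta$. That is: $P_p(X)$ is a complete Wasserstein algebra of order $p$; $\delta$ is nonexpansive; and for every complete Wasserstein algebra $B$ of order $p$ and every nonexpansive map $f:X\to B$ there is a unique nonexpansive affine map $h:P_p(X)\to B$ with $h\circ\delta=f$. -/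

import Mathlib

open MeasureTheory
open scoped ENNReal

universe u v w

noncomputable section

namespace WassersteinAlgebra

/-- The weight `(r - q r) / (1 - q r)` of the skew associativity law. -/
def skewWeight (q r : unitInterval) : unitInterval :=
  ⟨((r : ℝ) - q * r) / (1 - q * r), by
    have hq0 := q.2.1
    have hq1 := q.2.2
    have hr0 := r.2.1
    have hr1 := r.2.2
    have h1 : (q : ℝ) * r ≤ r := mul_le_of_le_one_left hr0 hq1
    exact ⟨div_nonneg (by linarith) (by linarith),
      div_le_one_of_le₀ (by linarith) (by linarith)⟩⟩

/-- Barycentric algebras (abstract convex sets): `conv r x y` is the binary convex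
combination `x +_r y`, which takes `x` with weight `r` and `y` with weight `1 - r`. -/
class BarycentricAlgebra (A : Type*) where
  /-- The operation `x +_r y`. -/
  conv : unitInterval → A → A → A
  conv_one : ∀ x y : A, conv 1 x y = x
  conv_self : ∀ (r : unitInterval) (x : A), conv r x x = x
  conv_comm : ∀ (r : unitInterval) (x y : A), conv r x y = conv (unitInterval.symm r) y x
  conv_assoc : ∀ (q r : unitInterval), q < 1 → r < 1 → ∀ x y z : A,
    conv r (conv q x y) z = conv (q * r) x (conv (skewWeight q r) y z)

/-- Affine maps: homomorphisms of barycentric algebras. -/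
def IsAffine {A B : Type*} [BarycentricAlgebra A] [BarycentricAlgebra B] (h : A → B) : Prop :=
  ∀ (r : unitInterval) (x y : A),
    h (BarycentricAlgebra.conv r x y) = BarycentricAlgebra.conv r (h x) (h y)

/-- A metric space with a barycentric structure is a Wasserstein algebra of order `p` if the
operations are nonexpansive (`A × A` carries the max metric) and the Wasserstein condition of
order `p` holds. -/
structure IsWassersteinAlgebra (p : ℝ) (A : Type*) [MetricSpace A] [BarycentricAlgebra A] :
    Prop where
  nonexpansive : ∀ r : unitInterval,
    LipschitzWith 1 (fun z : A × A => BarycentricAlgebra.conv r z.1 z.2)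
  wasserstein : ∀ (r : unitInterval) (x x' y y' : A),
    dist (BarycentricAlgebra.conv r x y) (BarycentricAlgebra.conv r x' y') ^ p
      ≤ (r : ℝ) * dist x x' ^ p + (1 - (r : ℝ)) * dist y y' ^ p

/-- `A` is the free complete Wasserstein algebra of order `p` over the metric space `X`, with
universal arrow `η`: it is a complete Wasserstein algebra of order `p`, `η` is nonexpansive, and
every nonexpansive map from `X` to a complete Wasserstein algebra `B` of order `p` extends
uniquely along `η` to a nonexpansive affine map `A → B`. -/
structure IsFreeCompleteWassersteinAlgebra (p : ℝ) {X : Type u} {A : Type v}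
    [MetricSpace X] [MetricSpace A] [BarycentricAlgebra A] (η : X → A) : Prop where
  complete : CompleteSpace A
  isWassersteinAlgebra : IsWassersteinAlgebra p A
  nonexpansive : LipschitzWith 1 η
  existsUnique_extension : ∀ (B : Type w) [MetricSpace B] [CompleteSpace B]
    [BarycentricAlgebra B], IsWassersteinAlgebra p B →
    ∀ f : X → B, LipschitzWith 1 f →
      ∃! h : A → B, LipschitzWith 1 h ∧ IsAffine h ∧ ∀ x, h (η x) = f x

/-- Finite moment of order `p`. -/
def HasFiniteMoment (p : ℝ) {X : Type*} [MetricSpace X] [MeasurableSpace X] (μ : Measure X) :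
    Prop :=
  ∃ x₀ : X, ∫⁻ x, edist x₀ x ^ p ∂μ < ∞

/-- The Radon probability measures on `X` with finite moment of order `p`. For the Borel
σ-algebra, `Measure.InnerRegular` says that every Borel set is compact inner regular. -/
@[ext]
structure Pp (p : ℝ) (X : Type*) [MetricSpace X] [MeasurableSpace X] where
  /-- The underlying measure. -/
  toMeasure : Measure X
  isProbabilityMeasure : IsProbabilityMeasure toMeasure
  radon : toMeasure.InnerRegular
  hasFiniteMoment : HasFiniteMoment p toMeasure

/-- `γ` is a coupling between `μ` and `ν`: a probability measure on the Borel σ-algebra of the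
topological product `X × X` (in general larger than the product σ-algebra) with marginals
`μ` and `ν`. -/
structure IsCoupling {X : Type*} [MetricSpace X] [MeasurableSpace X]
    (γ : @Measure (X × X) (borel (X × X))) (μ ν : Measure X) : Prop where
  isProbabilityMeasure : @IsProbabilityMeasure (X × X) (borel (X × X)) γ
  map_fst : @Measure.map (X × X) X (borel (X × X)) _ Prod.fst γ = μ
  map_snd : @Measure.map (X × X) X (borel (X × X)) _ Prod.snd γ = ν

/-- The Wasserstein distance of order `p`, as an extended nonnegative real:
`(inf_γ ∫ d^p dγ)^(1/p)`, where `γ` runs over the couplings between `μ` and `ν`. -/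
def wassersteinDist (p : ℝ) {X : Type*} [MetricSpace X] [MeasurableSpace X] (μ ν : Measure X) :
    ℝ≥0∞ :=
  (⨅ (γ : @Measure (X × X) (borel (X × X))) (_ : IsCoupling γ μ ν),
    ∫⁻ z, edist z.1 z.2 ^ p ∂γ) ^ (1 / p)

section Pp

variable {p : ℝ} {X : Type*} [MetricSpace X] [MeasurableSpace X]

theorem HasFiniteMoment.all [Fact (1 ≤ p)] [BorelSpace X] {μ : Measure X} [IsFiniteMeasure μ]
    (h : HasFiniteMoment p μ) (y : X) : ∫⁻ x, edist y x ^ p ∂μ < ∞ := by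
  obtain ⟨x₀, hx₀⟩ := h
  have hp : 1 ≤ p := Fact.out
  have hm : Measurable fun x => edist x₀ x ^ p :=
    (measurable_edist_right).pow_const p
  calc ∫⁻ x, edist y x ^ p ∂μ
      ≤ ∫⁻ x, (2 : ℝ≥0∞) ^ (p - 1) * (edist y x₀ ^ p + edist x₀ x ^ p) ∂μ := by
        refine lintegral_mono fun x => ?_
        exact (ENNReal.rpow_le_rpow (edist_triangle y x₀ x) (by linarith)).trans
          (ENNReal.rpow_add_le_mul_rpow_add_rpow _ _ hp)
    _ = (2 : ℝ≥0∞) ^ (p - 1) * (edist y x₀ ^ p * μ Set.univ + ∫⁻ x, edist x₀ x ^ p ∂μ) := by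
        rw [lintegral_const_mul _ (hm.const_add _), lintegral_add_right _ hm, lintegral_const]
    _ < ∞ := by
        have h1 : edist y x₀ ^ p < ∞ := ENNReal.rpow_lt_top_of_nonneg (by linarith) (edist_ne_top _ _)
        have h2 : (2 : ℝ≥0∞) ^ (p - 1) < ∞ :=
          ENNReal.rpow_lt_top_of_nonneg (by linarith) (by norm_num)
        exact ENNReal.mul_lt_top h2
          (ENNReal.add_lt_top.2 ⟨ENNReal.mul_lt_top h1 (measure_lt_top _ _), hx₀⟩)

/-- The measure `r μ + (1 - r) ν`. -/
def convMeasure (r : unitInterval) (μ ν : Measure X) : Measure X :=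
  ENNReal.ofReal r • μ + ENNReal.ofReal (1 - r) • ν

/-- The convex combination `μ +_r ν`, given on Borel sets by
`(μ +_r ν) B = r μ B + (1 - r) ν B`. -/
def Pp.conv [Fact (1 ≤ p)] [BorelSpace X] (r : unitInterval) (μ ν : Pp p X) : Pp p X where
  toMeasure := convMeasure r μ.toMeasure ν.toMeasure
  isProbabilityMeasure := by
    have := μ.isProbabilityMeasure
    have := ν.isProbabilityMeasure
    constructor
    simp only [convMeasure, Measure.coe_add, Measure.coe_smul, Pi.add_apply, Pi.smul_apply,
      measure_univ, smul_eq_mul, mul_one]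
    rw [← ENNReal.ofReal_add r.2.1 (by linarith [r.2.2])]
    simp
  radon := by
    have := μ.radon
    have := ν.radon
    unfold convMeasure
    infer_instance
  hasFiniteMoment := by
    have := μ.isProbabilityMeasure
    have := ν.isProbabilityMeasure
    obtain ⟨x₀, hx₀⟩ := μ.hasFiniteMoment
    have hν := ν.hasFiniteMoment.all x₀
    refine ⟨x₀, ?_⟩
    unfold convMeasure
    rw [lintegral_add_measure, lintegral_smul_measure, lintegral_smul_measure]
    simp only [smul_eq_mul]
    exact ENNReal.add_lt_top.2 ⟨ENNReal.mul_lt_top ENNReal.ofReal_lt_top hx₀,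
      ENNReal.mul_lt_top ENNReal.ofReal_lt_top hν⟩

theorem ofReal_smul_smul {X : Type*} [MeasurableSpace X] {a b : ℝ} (ha : 0 ≤ a) (μ : Measure X) :
    ENNReal.ofReal a • ENNReal.ofReal b • μ = ENNReal.ofReal (a * b) • μ := by
  rw [smul_smul, ENNReal.ofReal_mul ha]

instance [Fact (1 ≤ p)] [BorelSpace X] : BarycentricAlgebra (Pp p X) where
  conv := Pp.conv
  conv_one μ ν := by
    ext1
    simp [Pp.conv, convMeasure]
  conv_self r μ := by
    ext1
    simp only [Pp.conv, convMeasure]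
    rw [← add_smul, ← ENNReal.ofReal_add r.2.1 (by linarith [r.2.2])]
    simp
  conv_comm r μ ν := by
    ext1
    simp [Pp.conv, convMeasure, add_comm]
  conv_assoc q r hq hr μ ν ξ := by
    ext1
    have hq0 := q.2.1
    have hq1 : (q : ℝ) < 1 := hq
    have hr0 := r.2.1
    have hr1 : (r : ℝ) < 1 := hr
    have h1 : (q : ℝ) * r < 1 := by nlinarith
    have h2 : (1 - (q : ℝ) * r) ≠ 0 := by linarith
    have h3 : (0 : ℝ) ≤ 1 - q * r := by linarith
    simp only [Pp.conv, convMeasure, smul_add, ofReal_smul_smul hr0,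
      Set.Icc.coe_mul, ofReal_smul_smul h3]
    have e1 : (1 - (q : ℝ) * r) * (skewWeight q r : ℝ) = r * (1 - q) := by
      simp only [skewWeight]
      field_simp
    have e2 : (1 - (q : ℝ) * r) * (1 - (skewWeight q r : ℝ)) = 1 - r := by
      rw [mul_sub, e1]; ring
    rw [e1, e2, mul_comm (r : ℝ) q, add_assoc]

/-- The Dirac delta function `X → Pp p X`. -/
def Pp.dirac (p : ℝ) [Fact (1 ≤ p)] [BorelSpace X] (x : X) : Pp p X where
  toMeasure := Measure.dirac x
  isProbabilityMeasure := inferInstance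
  radon := by
    refine ⟨fun U hU r hr => ⟨U ∩ {x}, Set.inter_subset_left, ?_, ?_⟩⟩
    · exact ((Set.finite_singleton x).inter_of_right U).isCompact
    · rw [Measure.dirac_apply' _ hU] at hr
      rw [Measure.dirac_apply' _ (hU.inter (measurableSet_singleton x))]
      by_cases hx : x ∈ U <;> simp_all
  hasFiniteMoment := by
    have hp : (1 : ℝ) ≤ p := Fact.out
    refine ⟨x, ?_⟩
    rw [lintegral_dirac, edist_self, ENNReal.zero_rpow_of_pos (by linarith)]
    exact ENNReal.zero_lt_top

end Pp

end WassersteinAlgebra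

end

/-! A coupling is treated as a pair of random variables, and `wassersteinDist` as an infimum of
`L^p` distances. A Radon probability measure is carried by a closed separable set, so countably many
of them live on one Polish subset `S`. There conditional laws exist, and consecutive couplings can
be glued into a Markov chain (`exists_gluing`). Minkowski's inequality along the chain gives the
triangle inequality. For completeness, near-optimal couplings along a rapidly Cauchy sequence of
measures become an `L^p`-Cauchy sequence of random variables, and the law of its limit is the limit
measure. The Wasserstein condition comes from mixing couplings.

For freeness, finitely supported measures are dense (`dense_finitelySupported`), and on them an
affine extension of `f` can only be the barycenter of `f`. To compute with finite convex
combinations, `B` is embedded in its cone, an `ℝ≥0`-module in which barycenters are ordinary sums.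
There the binary Wasserstein condition iterates to a finite one (`costLE_sum`). A coupling of
finitely supported measures is again carried by a finite set, so this makes the barycenter map
nonexpansive (`edist_le_of_ι_eq_barycenter`), and it extends by density. -/

noncomputable section

namespace WassersteinAlgebra

/-! ### The cone over a barycentric algebra, as an `ℝ≥0`-module. -/

section ConeConstruction

open scoped NNReal
open BarycentricAlgebra (conv conv_one conv_self conv_comm conv_assoc)

/-- The weight `s / (s + t)` of the first point in the barycenter of two weighted points. -/
def ratio (s t : ℝ≥0) : unitInterval :=
  ⟨((s / (s + t) : ℝ≥0) : ℝ), NNReal.coe_nonneg _,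
    NNReal.coe_le_one.2 (div_le_one_of_le₀ le_self_add (zero_le))⟩

theorem coe_ratio (s t : ℝ≥0) : (ratio s t : ℝ) = s / (s + t) := by
  simp [ratio]

theorem symm_ratio {s t : ℝ≥0} (hs : s ≠ 0) : unitInterval.symm (ratio s t) = ratio t s := by
  ext
  have : (s : ℝ) + t ≠ 0 := by positivity
  rw [unitInterval.coe_symm_eq, coe_ratio, coe_ratio, add_comm (t : ℝ)]
  field_simp
  ring

theorem ratio_lt_one {s t : ℝ≥0} (ht : t ≠ 0) : ratio s t < 1 := by
  rw [← Subtype.coe_lt_coe, coe_ratio]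
  have h : (0 : ℝ) < t := by positivity
  have h' : (0 : ℝ) ≤ s := s.2
  change (s : ℝ) / (s + t) < 1
  rw [div_lt_one (by positivity)]
  linarith

theorem ratio_mul_ratio {s t u : ℝ≥0} (hs : s ≠ 0) :
    ratio s t * ratio (s + t) u = ratio s (t + u) := by
  ext
  have : (s : ℝ) + t ≠ 0 := by positivity
  have : (s : ℝ) + t + u ≠ 0 := by positivity
  have : (s : ℝ) + (t + u) ≠ 0 := by positivity
  simp only [Set.Icc.coe_mul, coe_ratio, NNReal.coe_add]
  field_simp
  ring

/-- With `ratio_mul_ratio`, this says that the weights of the skew associativity law are those of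
rebracketing three weighted points, so the law becomes associativity of addition in the cone. -/
theorem skewWeight_ratio {s t u : ℝ≥0} (hs : s ≠ 0) (ht : t ≠ 0) :
    skewWeight (ratio s t) (ratio (s + t) u) = ratio t u := by
  ext
  have : (s : ℝ) + t ≠ 0 := by positivity
  have h1 : (s : ℝ) + t + u ≠ 0 := by positivity
  have h2 : (t : ℝ) + u ≠ 0 := by positivity
  have e : (ratio s t : ℝ) * ratio (s + t) u = s / (s + t + u) := by
    rw [coe_ratio, coe_ratio, NNReal.coe_add]
    field_simp
  simp only [skewWeight, e]
  rw [coe_ratio, coe_ratio, NNReal.coe_add, ← sub_div, one_sub_div h1]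
  rw [div_div_div_cancel_right₀ h1]
  congr 1 <;> ring

theorem conv_zero {A : Type*} [BarycentricAlgebra A] (x y : A) : conv 0 x y = y := by
  rw [conv_comm, unitInterval.symm_zero, conv_one]

/-- The cone over a barycentric algebra: the points of `A` with positive weights, and a zero. -/
inductive Cone (A : Type*) : Type _
  | zero : Cone A
  | pos (t : ℝ≥0) (ht : t ≠ 0) (a : A) : Cone A

namespace Cone

variable {A : Type*}

/-- Multiplication of the weight. -/
def smul (c : ℝ≥0) : Cone A → Cone A
  | zero => zero
  | pos s hs x => if hc : c = 0 then zero else pos (c * s) (mul_ne_zero hc hs) x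

instance : Zero (Cone A) := ⟨zero⟩
instance : SMul ℝ≥0 (Cone A) := ⟨smul⟩

theorem zero_eq : (zero : Cone A) = 0 := rfl

theorem smul_pos {c s : ℝ≥0} (hc : c ≠ 0) (hs : s ≠ 0) (x : A) :
    c • pos s hs x = pos (c * s) (mul_ne_zero hc hs) x := dif_neg hc

theorem zero_smul' (u : Cone A) : (0 : ℝ≥0) • u = 0 := by
  cases u
  · rfl
  · exact dif_pos rfl

theorem smul_zero' (c : ℝ≥0) : c • (0 : Cone A) = 0 := rfl

theorem mul_smul' (c d : ℝ≥0) (u : Cone A) : (c * d) • u = c • d • u := by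
  rcases eq_or_ne c 0 with rfl | hc
  · simp only [zero_smul', zero_mul]
  rcases eq_or_ne d 0 with rfl | hd
  · simp only [zero_smul', mul_zero, smul_zero']
  cases u with
  | zero => rfl
  | pos s hs x => simp only [smul_pos hc, smul_pos hd, smul_pos (mul_ne_zero hc hd), mul_assoc]

/-- The inclusion of `A` into its cone as the points of weight one. -/
def ι (x : A) : Cone A := pos 1 one_ne_zero x

theorem ι_injective : Function.Injective (ι : A → Cone A) := fun x y h => by
  simpa [ι] using h

theorem smul_ι {c : ℝ≥0} (hc : c ≠ 0) (x : A) : c • ι x = pos c hc x := by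
  simp only [ι, smul_pos hc, mul_one]

variable [BarycentricAlgebra A]

/-- Weights add up, and the points are replaced by their barycenter. -/
def add : Cone A → Cone A → Cone A
  | zero, v => v
  | pos s hs x, zero => pos s hs x
  | pos s hs x, pos t _ y => pos (s + t) (by positivity) (conv (ratio s t) x y)

instance : Add (Cone A) := ⟨add⟩

theorem pos_add_pos {s t : ℝ≥0} (hs : s ≠ 0) (ht : t ≠ 0) (x y : A) :
    pos s hs x + pos t ht y = pos (s + t) (by positivity) (conv (ratio s t) x y) := rfl

theorem zero_add' (u : Cone A) : 0 + u = u := rfl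

theorem add_zero' (u : Cone A) : u + 0 = u := by cases u <;> rfl

theorem add_comm' (u v : Cone A) : u + v = v + u := by
  cases u with
  | zero => rw [zero_eq, zero_add', add_zero']
  | pos s hs x =>
    cases v with
    | zero => rw [zero_eq, zero_add', add_zero']
    | pos t ht y =>
      simp only [pos_add_pos, add_comm t s, conv_comm (ratio s t), symm_ratio hs]

theorem add_assoc' (u v z : Cone A) : u + v + z = u + (v + z) := by
  cases u with
  | zero => simp only [zero_eq, zero_add']
  | pos s hs x =>
    cases v with
    | zero => simp only [zero_eq, zero_add', add_zero']
    | pos t ht y =>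
      cases z with
      | zero => simp only [zero_eq, add_zero']
      | pos r hr z =>
        simp only [pos_add_pos, add_assoc s t r]
        rw [conv_assoc _ _ (ratio_lt_one ht) (ratio_lt_one hr), ratio_mul_ratio hs,
          skewWeight_ratio hs ht]

instance : AddCommMonoid (Cone A) where
  add_assoc := add_assoc'
  zero_add := zero_add'
  add_zero := add_zero'
  add_comm := add_comm'
  nsmul := nsmulRec

theorem smul_add' (c : ℝ≥0) (u v : Cone A) : c • (u + v) = c • u + c • v := by
  rcases eq_or_ne c 0 with rfl | hc
  · simp only [zero_smul', add_zero]
  cases u with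
  | zero => simp only [zero_eq, zero_add, smul_zero']
  | pos s hs x =>
    cases v with
    | zero => simp only [zero_eq, add_zero, smul_zero']
    | pos t ht y =>
      have e : ratio (c * s) (c * t) = ratio s t := by
        ext
        have : (c : ℝ) ≠ 0 := by positivity
        have : (s : ℝ) + t ≠ 0 := by positivity
        rw [coe_ratio, coe_ratio, NNReal.coe_mul, NNReal.coe_mul, ← mul_add,
          mul_div_mul_left _ _ ‹(c : ℝ) ≠ 0›]
      simp only [pos_add_pos, smul_pos hc, mul_add, e]

theorem add_smul' (c d : ℝ≥0) (u : Cone A) : (c + d) • u = c • u + d • u := by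
  rcases eq_or_ne c 0 with rfl | hc
  · simp only [zero_smul', zero_add]
  rcases eq_or_ne d 0 with rfl | hd
  · simp only [zero_smul', add_zero]
  cases u with
  | zero => simp only [zero_eq, add_zero, smul_zero']
  | pos s hs x =>
    have hcd : c + d ≠ 0 := by positivity
    simp only [smul_pos hc, smul_pos hd, smul_pos hcd, pos_add_pos, conv_self, add_mul]

instance : Module ℝ≥0 (Cone A) where
  one_smul u := by
    cases u
    · rfl
    · simp only [smul_pos one_ne_zero, one_mul]
  mul_smul := mul_smul'
  smul_zero := smul_zero'
  smul_add := smul_add'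
  add_smul := add_smul'
  zero_smul := zero_smul'

/-- The weight of a unit interval element, as a nonnegative real. -/
def weight (r : unitInterval) : ℝ≥0 := ⟨r, r.2.1⟩

theorem coe_weight (r : unitInterval) : (weight r : ℝ) = r := rfl

theorem coe_weight_symm (r : unitInterval) :
    (weight (unitInterval.symm r) : ℝ) = 1 - r := rfl

theorem ratio_eq {s t : ℝ≥0} {r : unitInterval} (h : (s : ℝ) + t = 1) (hs : (s : ℝ) = r) :
    ratio s t = r := by
  ext
  rw [coe_ratio, h, hs, div_one]

theorem weight_eq_zero {r : unitInterval} : weight r = 0 ↔ r = 0 := by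
  rw [← NNReal.coe_eq_zero, coe_weight]
  exact Set.Icc.coe_eq_zero

/-- A map from a barycentric algebra to an `ℝ≥0`-module preserves convex combinations. -/
def PreservesConv {M : Type*} [AddCommMonoid M] [Module ℝ≥0 M] (φ : A → M) : Prop :=
  ∀ (r : unitInterval) (x y : A),
    φ (conv r x y) = weight r • φ x + weight (unitInterval.symm r) • φ y

theorem preservesConv_ι : PreservesConv (ι : A → Cone A) := by
  intro r x y
  -- The endpoints are separate because scaling by zero collapses a point to the zero of the cone,
  -- where the addition formula for positive weights does not apply.
  rcases eq_or_ne r 0 with rfl | h0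
  · have h1 : weight (unitInterval.symm 0) = 1 := by
      ext; rw [coe_weight_symm]; simp
    rw [conv_zero, h1, weight_eq_zero.2 rfl, zero_smul, zero_add, one_smul]
  rcases eq_or_ne r 1 with rfl | h1
  · have h1 : weight 1 = 1 := by
      ext; rw [coe_weight]; simp
    rw [conv_one, h1, unitInterval.symm_one, weight_eq_zero.2 rfl, zero_smul, add_zero, one_smul]
  have hs : weight (unitInterval.symm r) ≠ 0 := by
    rw [Ne, weight_eq_zero]
    exact fun h => h1 (unitInterval.symm_eq_zero.1 h)
  have hr : weight r ≠ 0 := by rwa [Ne, weight_eq_zero]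
  have h : (weight r : ℝ) + weight (unitInterval.symm r) = 1 := by
    rw [coe_weight, coe_weight_symm]; ring
  have h' : weight r + weight (unitInterval.symm r) = 1 := by exact_mod_cast h
  simp only [smul_ι hr, smul_ι hs, pos_add_pos, h', ratio_eq h (coe_weight r)]
  rfl

/-- Since `ι` is injective, affinity can be tested in the cone; this lets `lift` turn an affine map
into a linear one. -/
theorem isAffine_iff_preservesConv {B : Type*} [BarycentricAlgebra B] {h : A → B} :
    IsAffine h ↔ PreservesConv fun x => ι (h x) := by
  refine forall_congr' fun r => forall_congr' fun x => forall_congr' fun y => ?_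
  rw [← preservesConv_ι, ι_injective.eq_iff]

/-- The linear extension to the cone of a map that preserves convex combinations. -/
def lift {M : Type*} [AddCommMonoid M] [Module ℝ≥0 M] (φ : A → M) (hφ : PreservesConv φ) :
    Cone A →ₗ[ℝ≥0] M where
  toFun
    | zero => 0
    | pos t _ x => t • φ x
  map_add' u v := by
    cases u with
    | zero => simp only [zero_eq, zero_add]
    | pos s hs x =>
      cases v with
      | zero => simp only [zero_eq, add_zero]
      | pos t ht y =>
        have e1 : (s + t) * weight (ratio s t) = s := by
          ext
          have : (s : ℝ) + t ≠ 0 := by positivity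
          rw [NNReal.coe_mul, coe_weight, coe_ratio, NNReal.coe_add]
          field_simp
        have e2 : (s + t) * weight (ratio t s) = t := by
          ext
          have : (t : ℝ) + s ≠ 0 := by positivity
          rw [NNReal.coe_mul, coe_weight, coe_ratio, NNReal.coe_add, add_comm (s : ℝ)]
          field_simp
        simp only [pos_add_pos]
        rw [hφ, smul_add, smul_smul, smul_smul, symm_ratio hs, e1, e2]
  map_smul' c u := by
    rcases eq_or_ne c 0 with rfl | hc
    · simp only [zero_smul, RingHom.id_apply]
    cases u with
    | zero => simp only [zero_eq, smul_zero]
    | pos s hs x => simp only [smul_pos hc, smul_smul, RingHom.id_apply]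

@[simp]
theorem lift_ι {M : Type*} [AddCommMonoid M] [Module ℝ≥0 M] (φ : A → M) (hφ : PreservesConv φ)
    (x : A) : lift φ hφ (ι x) = φ x :=
  one_smul _ _

/-- The total weight. -/
def mass : Cone A →ₗ[ℝ≥0] ℝ≥0 :=
  lift (fun _ => 1) fun r _ _ => by
    ext
    simp [coe_weight]

theorem mass_ι (x : A) : mass (ι x) = 1 := lift_ι ..

/-- The way back from the cone: a finite sum whose weights add up to one is an actual point of `A`.
-/
theorem exists_ι_eq {u : Cone A} (hu : mass u = 1) : ∃ x, ι x = u := by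
  cases u with
  | zero => exact absurd hu zero_ne_one
  | pos t ht x =>
    have : t = 1 := by simpa [mass, lift] using hu
    subst this
    exact ⟨x, rfl⟩

/-- `u` and `v` have the same weight, and this weight times the `p`-th power of the distance of
the points is at most `c`. -/
def CostLE {B : Type*} [MetricSpace B] (p c : ℝ) : Cone B → Cone B → Prop
  | zero, zero => 0 ≤ c
  | pos s _ x, pos t _ y => s = t ∧ s * dist x y ^ p ≤ c
  | _, _ => False

section CostLE

variable {B : Type*} [MetricSpace B] {p : ℝ}

theorem dist_rpow_le_of_costLE {c : ℝ} {x y : B} (h : CostLE p c (ι x) (ι y)) :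
    dist x y ^ p ≤ c := by
  simpa using h.2

variable [BarycentricAlgebra B]

/-- This is the Wasserstein condition with `r = s / (s + s')`, multiplied by `s + s'`. Without
normalization the bound is additive, so it passes to finite sums by induction. -/
theorem CostLE.add (hB : IsWassersteinAlgebra p B) {c d : ℝ} {u v u' v' : Cone B}
    (h : CostLE p c u v) (h' : CostLE p d u' v') : CostLE p (c + d) (u + u') (v + v') := by
  match u, v, u', v', h, h' with
  | zero, zero, zero, zero, h, h' => exact add_nonneg h h'
  | zero, zero, pos s hs x, pos t ht y, h, h' =>
    exact ⟨h'.1, h'.2.trans (le_add_of_nonneg_left h)⟩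
  | pos s hs x, pos t ht y, zero, zero, h, h' =>
    exact ⟨h.1, h.2.trans (le_add_of_nonneg_right h')⟩
  | pos s hs x, pos t ht y, pos s' hs' x', pos t' ht' y', h, h' =>
    obtain ⟨rfl, h⟩ := h
    obtain ⟨rfl, h'⟩ := h'
    refine ⟨rfl, ?_⟩
    have hss : (0 : ℝ) < (s + s' : ℝ≥0) := by positivity
    have e1 : ((s + s' : ℝ≥0) : ℝ) * ratio s s' = s := by
      rw [coe_ratio, NNReal.coe_add] at *
      field_simp
    calc ((s + s' : ℝ≥0) : ℝ) * dist (conv (ratio s s') x x') (conv (ratio s s') y y') ^ p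
        ≤ ((s + s' : ℝ≥0) : ℝ) * ((ratio s s' : ℝ) * dist x y ^ p
          + (1 - (ratio s s' : ℝ)) * dist x' y' ^ p) :=
          mul_le_mul_of_nonneg_left (hB.wasserstein _ _ _ _ _) hss.le
      _ = s * dist x y ^ p + s' * dist x' y' ^ p := by
          rw [mul_add, ← mul_assoc, ← mul_assoc, mul_sub, e1, mul_one, NNReal.coe_add,
            add_sub_cancel_left]
      _ ≤ c + d := add_le_add h h'

theorem costLE_smul_ι (c : ℝ≥0) (x y : B) : CostLE p (c * dist x y ^ p) (c • ι x) (c • ι y) := by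
  rcases eq_or_ne c 0 with rfl | hc
  · simp only [zero_smul, NNReal.coe_zero, zero_mul]
    exact le_refl (0 : ℝ)
  · rw [smul_ι hc, smul_ι hc]
    exact ⟨rfl, le_rfl⟩

theorem costLE_sum (hB : IsWassersteinAlgebra p B) {I : Type*} (s : Finset I) (c : I → ℝ≥0)
    (x y : I → B) :
    CostLE p (∑ i ∈ s, c i * dist (x i) (y i) ^ p) (∑ i ∈ s, c i • ι (x i))
      (∑ i ∈ s, c i • ι (y i)) := by
  classical
  induction s using Finset.induction_on with
  | empty => exact le_refl (0 : ℝ)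
  | insert i s hi ih =>
    simp only [Finset.sum_insert hi]
    exact (costLE_smul_ι _ _ _).add hB ih

end CostLE

end Cone

end ConeConstruction

/-! ### Gluing couplings into a Markov chain. -/

section Chain

open ProbabilityTheory Preorder

/-- A kernel that sees its input only through `g` allows the input to be replaced by its image;
below, `g` forgets all of the history but the last state. -/
theorem map_prodMap_compProd_comap {α β Ω : Type*} [MeasurableSpace α] [MeasurableSpace β]
    [MeasurableSpace Ω] (μ : Measure α) [SFinite μ] {g : α → β} (hg : Measurable g)
    (κ : Kernel β Ω) [IsSFiniteKernel κ] :
    (μ.compProd (κ.comap g hg)).map (Prod.map g id) = (μ.map g).compProd κ := by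
  ext s hs
  have hgm : Measurable (Prod.map g (id : Ω → Ω)) := hg.prodMap measurable_id
  rw [Measure.map_apply hgm hs, Measure.compProd_apply (hgm hs), Measure.compProd_apply hs,
    lintegral_map (Kernel.measurable_kernel_prodMk_left hs) hg]
  rfl

theorem map_eval_zero_trajMeasure {E : Type*} [MeasurableSpace E] (μ : Measure E)
    [IsProbabilityMeasure μ] (κ : (n : ℕ) → Kernel (Finset.Iic n → E) E)
    [∀ n, IsMarkovKernel (κ n)] :
    (Kernel.trajMeasure (X := fun _ => E) μ κ).map (fun x => x 0) = μ := by
  have h0 : (Kernel.trajMeasure (X := fun _ => E) μ κ).map (frestrictLe 0) =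
      μ.map (MeasurableEquiv.piUnique (fun _ : Finset.Iic 0 => E)).symm := by
    rw [Kernel.trajMeasure, Measure.map_comp _ _ (by fun_prop), Kernel.traj_map_frestrictLe,
      Kernel.partialTraj_self, Measure.id_comp]
  have h1 : (fun x : ℕ → E => x 0) =
      (MeasurableEquiv.piUnique (fun _ : Finset.Iic 0 => E)) ∘ frestrictLe 0 := by
    ext x
    rfl
  rw [h1, ← Measure.map_map (by fun_prop) (by fun_prop), h0,
    Measure.map_map (by fun_prop) (by fun_prop), MeasurableEquiv.self_comp_symm, Measure.map_id]

/-- Countably many couplings with matching marginals can be glued. -/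
theorem exists_measure_map_eval_eq {E : Type*} [MeasurableSpace E] [StandardBorelSpace E]
    [Nonempty E] (γ : ℕ → Measure (E × E)) [∀ n, IsProbabilityMeasure (γ n)]
    (hγ : ∀ n, (γ n).snd = (γ (n + 1)).fst) :
    ∃ P : Measure (ℕ → E), IsProbabilityMeasure P ∧
      ∀ n, P.map (fun x => (x n, x (n + 1))) = γ n := by
  let last (n : ℕ) (x : Finset.Iic n → E) : E := x ⟨n, Finset.mem_Iic.2 le_rfl⟩
  have hlast (n : ℕ) : Measurable (last n) := measurable_pi_apply _
  -- The transition at time `n` is the conditional law under `γ n` of the second coordinate given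
  -- the first, evaluated at the current state.
  let κ (n : ℕ) : Kernel (Finset.Iic n → E) E := (γ n).condKernel.comap (last n) (hlast n)
  let P : Measure (ℕ → E) := Kernel.trajMeasure (X := fun _ => E) (γ 0).fst κ
  have step (n : ℕ) (h : P.map (fun x => x n) = (γ n).fst) :
      P.map (fun x => (x n, x (n + 1))) = γ n := by
    have h1 := Kernel.map_frestrictLe_trajMeasure_compProd_eq_map_trajMeasure
      (X := fun _ => E) (μ₀ := (γ 0).fst) (κ := κ) (a := n)
    have h2 := congrArg (Measure.map (Prod.map (last n) id)) h1
    rw [map_prodMap_compProd_comap, Measure.map_map (hlast n) (by fun_prop),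
      Measure.map_map ((hlast n).prodMap measurable_id) (by fun_prop)] at h2
    change (P.map (fun x => x n)).compProd _ = P.map (fun x => (x n, x (n + 1))) at h2
    rw [← h2, h, (γ n).disintegrate]
  have hP (n : ℕ) : P.map (fun x => x n) = (γ n).fst := by
    induction n with
    | zero => exact map_eval_zero_trajMeasure _ _
    | succ n ih =>
      rw [← hγ n, ← step n ih, Measure.snd, Measure.map_map (by fun_prop) (by fun_prop)]
      rfl
  exact ⟨P, inferInstance, fun n => step n (hP n)⟩

end Chain

/-- A closed separable set that carries all the measures of a countable family. -/
theorem exists_isClosed_isSeparable_measure_compl {X I : Type*} [Countable I] [MetricSpace X]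
    [MeasurableSpace X] [BorelSpace X] (μ : I → Measure X) [∀ i, IsFiniteMeasure (μ i)]
    (hμ : ∀ i, (μ i).InnerRegular) :
    ∃ S : Set X, IsClosed S ∧ TopologicalSpace.IsSeparable S ∧ ∀ i, μ i Sᶜ = 0 := by
  have h (i : I) (n : ℕ) : ∃ K : Set X, IsCompact K ∧ μ i Kᶜ < (n + 1 : ℝ≥0∞)⁻¹ := by
    have := hμ i
    obtain ⟨K, -, hK, h⟩ := MeasurableSet.univ.exists_isCompact_sdiff_lt (μ := μ i)
      (measure_ne_top _ _) (ε := (n + 1 : ℝ≥0∞)⁻¹) (by simp)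
    exact ⟨K, hK, by rwa [← Set.compl_eq_univ_sdiff] at h⟩
  choose K hK hμK using h
  -- Each `μ i` is carried up to `1 / (n + 1)` by a compact, hence separable, set; countably many
  -- such sets suffice for the whole family.
  refine ⟨closure (⋃ i, ⋃ n, K i n), isClosed_closure, ?_, fun i => ?_⟩
  · exact (TopologicalSpace.IsSeparable.iUnion fun i =>
      TopologicalSpace.IsSeparable.iUnion fun n => (hK i n).isSeparable).closure
  · have hlim : Filter.Tendsto (fun n : ℕ => ((n : ℝ≥0∞) + 1)⁻¹) Filter.atTop (nhds 0) :=
      (ENNReal.tendsto_inv_nat_nhds_zero.comp (Filter.tendsto_add_atTop_nat 1)).congr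
        fun n => by simp
    refine le_antisymm (ge_of_tendsto' hlim fun n => ?_) zero_le
    refine (measure_mono (Set.compl_subset_compl.2 ?_)).trans (hμK i n).le
    exact (Set.subset_iUnion₂ (s := fun i n => K i n) i n).trans subset_closure

/-- The topological square of `X` with its Borel σ-algebra. -/
def BorelSquare (X : Type*) : Type _ := X × X

/-! ### Couplings on the Borel square. -/

section BorelSquare

variable {X : Type*} [MetricSpace X]

instance : TopologicalSpace (BorelSquare X) := inferInstanceAs (TopologicalSpace (X × X))
instance : MeasurableSpace (BorelSquare X) := borel (X × X)
instance : BorelSpace (BorelSquare X) := ⟨rfl⟩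
instance : T1Space (BorelSquare X) := inferInstanceAs (T1Space (X × X))

/-- The first projection. -/
def BorelSquare.fst (z : BorelSquare X) : X := Prod.fst z

/-- The second projection. -/
def BorelSquare.snd (z : BorelSquare X) : X := Prod.snd z

/-- The pair `(x, y)`. -/
def BorelSquare.mk (x y : X) : BorelSquare X := (x, y)

theorem BorelSquare.continuous_fst : Continuous (BorelSquare.fst : BorelSquare X → X) :=
  _root_.continuous_fst

theorem BorelSquare.continuous_snd : Continuous (BorelSquare.snd : BorelSquare X → X) :=
  _root_.continuous_snd

theorem BorelSquare.measurable_edist_rpow (p : ℝ) :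
    Measurable fun z : BorelSquare X => edist z.fst z.snd ^ p :=
  ((BorelSquare.continuous_fst.edist BorelSquare.continuous_snd).measurable).pow_const p

variable [MeasurableSpace X]

/-- `IsCoupling`, for measures on `BorelSquare X`. -/
def Couples (γ : Measure (BorelSquare X)) (μ ν : Measure X) : Prop := IsCoupling γ μ ν

/-- The optimal transport cost, the `p`-th power of the Wasserstein distance. -/
def transportCost (p : ℝ) (μ ν : Measure X) : ℝ≥0∞ :=
  ⨅ (γ : Measure (BorelSquare X)) (_ : Couples γ μ ν), ∫⁻ z, edist z.fst z.snd ^ p ∂γ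

theorem wassersteinDist_eq (p : ℝ) (μ ν : Measure X) :
    wassersteinDist p μ ν = transportCost p μ ν ^ (1 / p) := rfl

theorem couples_iff {γ : Measure (BorelSquare X)} {μ ν : Measure X} :
    Couples γ μ ν ↔
      IsProbabilityMeasure γ ∧ γ.map BorelSquare.fst = μ ∧ γ.map BorelSquare.snd = ν :=
  ⟨fun h => ⟨h.1, h.2, h.3⟩, fun h => ⟨h.1, h.2.1, h.2.2⟩⟩

theorem transportCost_le_of_couples {p : ℝ} {γ : Measure (BorelSquare X)} {μ ν : Measure X}
    (h : Couples γ μ ν) : transportCost p μ ν ≤ ∫⁻ z, edist z.fst z.snd ^ p ∂γ :=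
  iInf₂_le γ h

theorem exists_couples_lt {p : ℝ} {μ ν : Measure X} {c : ℝ≥0∞} (h : transportCost p μ ν < c) :
    ∃ γ : Measure (BorelSquare X), Couples γ μ ν ∧ ∫⁻ z, edist z.fst z.snd ^ p ∂γ < c := by
  simpa only [transportCost, iInf_lt_iff, exists_prop] using h

theorem exists_couples_rpow_lt {p : ℝ} (hp : 0 < p) {μ ν : Measure X} {c : ℝ≥0∞}
    (h : wassersteinDist p μ ν < c) :
    ∃ γ : Measure (BorelSquare X), Couples γ μ ν ∧
      (∫⁻ z, edist z.fst z.snd ^ p ∂γ) ^ (1 / p) < c := by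
  rw [wassersteinDist_eq, one_div, ENNReal.rpow_inv_lt_iff hp] at h
  obtain ⟨γ, hγ, hlt⟩ := exists_couples_lt h
  exact ⟨γ, hγ, by rwa [one_div, ENNReal.rpow_inv_lt_iff hp]⟩

variable [BorelSpace X]

theorem BorelSquare.measurable_fst : Measurable (BorelSquare.fst : BorelSquare X → X) :=
  BorelSquare.continuous_fst.measurable

theorem BorelSquare.measurable_snd : Measurable (BorelSquare.snd : BorelSquare X → X) :=
  BorelSquare.continuous_snd.measurable

variable {Ω : Type*} [MeasurableSpace Ω]

/-- Measurability of the pair is a hypothesis, since that of `Y` and `Z` separately only gives it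
for the product σ-algebra. -/
theorem couples_map (P : Measure Ω) [IsProbabilityMeasure P] {Y Z : Ω → X}
    (h : Measurable fun ω => BorelSquare.mk (Y ω) (Z ω)) :
    Couples (P.map fun ω => BorelSquare.mk (Y ω) (Z ω)) (P.map Y) (P.map Z) := by
  refine couples_iff.2 ⟨Measure.isProbabilityMeasure_map h.aemeasurable, ?_, ?_⟩
  · rw [Measure.map_map BorelSquare.measurable_fst h]; rfl
  · rw [Measure.map_map BorelSquare.measurable_snd h]; rfl

theorem transportCost_map_le {p : ℝ} (P : Measure Ω) [IsProbabilityMeasure P] {Y Z : Ω → X}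
    (h : Measurable fun ω => BorelSquare.mk (Y ω) (Z ω)) :
    transportCost p (P.map Y) (P.map Z) ≤ ∫⁻ ω, edist (Y ω) (Z ω) ^ p ∂P := by
  refine (transportCost_le_of_couples (couples_map P h)).trans_eq ?_
  rw [lintegral_map (BorelSquare.measurable_edist_rpow p) h]
  rfl

/-- On a separable set the Borel σ-algebra of the square is the product σ-algebra, and the inclusion
into the square of `X` is continuous. -/
theorem measurable_mk_of_isSeparable {S : Set X} (hS : TopologicalSpace.IsSeparable S)
    {Y Z : Ω → S} (hY : Measurable Y) (hZ : Measurable Z) :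
    Measurable fun ω => BorelSquare.mk (Y ω : X) (Z ω : X) := by
  have := hS.secondCountableTopology
  have h : Continuous fun z : S × S => BorelSquare.mk (z.1 : X) (z.2 : X) :=
    (continuous_subtype_val.comp _root_.continuous_fst).prodMk
      (continuous_subtype_val.comp _root_.continuous_snd)
  exact h.measurable.comp (hY.prodMk hZ)

end BorelSquare

/-! ### Metric properties and convexity of the transport cost. -/

section Metric

variable {X : Type*} [MetricSpace X] [MeasurableSpace X] [BorelSpace X] {p : ℝ}

theorem transportCost_comm (μ ν : Measure X) : transportCost p μ ν = transportCost p ν μ := by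
  suffices ∀ μ ν : Measure X, transportCost p μ ν ≤ transportCost p ν μ from
    le_antisymm (this _ _) (this _ _)
  intro μ ν
  refine le_iInf₂ fun γ hγ => ?_
  obtain ⟨hP, rfl, rfl⟩ := couples_iff.1 hγ
  have h : Continuous fun z : BorelSquare X => BorelSquare.mk z.snd z.fst := continuous_swap
  refine (transportCost_map_le γ h.measurable).trans_eq ?_
  simp only [edist_comm]

theorem transportCost_self (hp : 0 < p) (μ : Measure X) [IsProbabilityMeasure μ] :
    transportCost p μ μ = 0 := by
  have h : Continuous fun x : X => BorelSquare.mk x x := continuous_id.prodMk continuous_id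
  have := transportCost_map_le (p := p) μ (Y := id) (Z := id) h.measurable
  simpa [hp] using this

theorem transportCost_dirac_le (μ : Measure X) [IsProbabilityMeasure μ] (y : X) :
    transportCost p μ (Measure.dirac y) ≤ ∫⁻ x, edist y x ^ p ∂μ := by
  have h : Continuous fun x : X => BorelSquare.mk x y := continuous_id.prodMk continuous_const
  have := transportCost_map_le (p := p) μ (Y := id) (Z := fun _ => y) h.measurable
  simpa [Measure.map_const, edist_comm y] using this

/-- By Markov's inequality, a coupling of cost below `δ ^ p * ε` moves mass at most `ε` by `δ` or
more, so `μ F` is at most `ε` plus the `ν`-measure of the `δ`-thickening. Then `ε` and `δ` tend to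
zero. -/
theorem measure_le_of_transportCost_eq_zero (hp : 0 < p) {μ ν : Measure X} [IsFiniteMeasure ν]
    (h : transportCost p μ ν = 0) {F : Set X} (hF : IsClosed F) : μ F ≤ ν F := by
  have key (δ : ℝ) (hδ : 0 < δ) : μ F ≤ ν (Metric.cthickening δ F) := by
    have hδ0 : ENNReal.ofReal δ ^ p ≠ 0 := by simp [hδ, hp]
    have hδt : ENNReal.ofReal δ ^ p ≠ ∞ := by simp [hp.le]
    refine ENNReal.le_of_forall_pos_le_add fun ε hε _ => ?_
    have hε' : (ε : ℝ≥0∞) ≠ 0 := by simpa using hε.ne'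
    have hc : transportCost p μ ν < ENNReal.ofReal δ ^ p * ε := by
      rw [h]
      exact pos_iff_ne_zero.2 (mul_ne_zero hδ0 hε')
    obtain ⟨γ, hγ, hlt⟩ := exists_couples_lt hc
    obtain ⟨hP, rfl, rfl⟩ := couples_iff.1 hγ
    have hM := mul_meas_ge_le_lintegral (μ := γ) (BorelSquare.measurable_edist_rpow p)
      (ENNReal.ofReal δ ^ p)
    have hM' : γ {z | ENNReal.ofReal δ ^ p ≤ edist z.fst z.snd ^ p} ≤ ε :=
      (ENNReal.mul_le_mul_iff_right hδ0 hδt).1 (hM.trans hlt.le)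
    rw [Measure.map_apply BorelSquare.measurable_fst hF.measurableSet,
      Measure.map_apply BorelSquare.measurable_snd Metric.isClosed_cthickening.measurableSet]
    refine (measure_mono ?_).trans ((measure_union_le _ _).trans (add_le_add_right hM' _))
    intro z hz
    by_cases hd : ENNReal.ofReal δ ≤ edist z.fst z.snd
    · exact Or.inr (ENNReal.rpow_le_rpow hd hp.le)
    · refine Or.inl ?_
      rw [not_le, edist_comm] at hd
      have hz' : z.fst ∈ F := hz
      exact (Metric.infEDist_le_edist_of_mem hz').trans hd.le
  have hlim := tendsto_measure_cthickening_of_isClosed (μ := ν) (s := F)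
    ⟨1, zero_lt_one, measure_ne_top _ _⟩ hF
  exact ge_of_tendsto (hlim.mono_left (nhdsWithin_le_nhds (s := Set.Ioi 0)))
    (Filter.eventually_of_mem self_mem_nhdsWithin key)

theorem eq_of_transportCost_eq_zero (hp : 0 < p) {μ ν : Measure X} [IsProbabilityMeasure μ]
    [IsProbabilityMeasure ν] (h : transportCost p μ ν = 0) : μ = ν := by
  refine ext_of_generate_finite _ ?_ isPiSystem_isClosed (fun F hF => ?_) (by simp)
  · rw [BorelSpace.measurable_eq (α := X), borel_eq_generateFrom_isClosed]
  · exact le_antisymm (measure_le_of_transportCost_eq_zero hp h hF)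
      (measure_le_of_transportCost_eq_zero hp (by rwa [transportCost_comm]) hF)

theorem Couples.smul_add_smul {γ γ' : Measure (BorelSquare X)} {μ ν μ' ν' : Measure X}
    (h : Couples γ μ ν) (h' : Couples γ' μ' ν') (r : unitInterval) :
    Couples (ENNReal.ofReal r • γ + ENNReal.ofReal (1 - r) • γ' : Measure (BorelSquare X))
      (convMeasure r μ μ') (convMeasure r ν ν') := by
  obtain ⟨hP, rfl, rfl⟩ := couples_iff.1 h
  obtain ⟨hP', rfl, rfl⟩ := couples_iff.1 h'
  refine couples_iff.2 ⟨⟨?_⟩, ?_, ?_⟩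
  · simp only [Measure.coe_add, Measure.coe_smul, Pi.add_apply, Pi.smul_apply,
      measure_univ, smul_eq_mul, mul_one]
    rw [← ENNReal.ofReal_add r.2.1 (by linarith [r.2.2])]
    simp
  · rw [Measure.map_add _ _ BorelSquare.measurable_fst, Measure.map_smul, Measure.map_smul]
    rfl
  · rw [Measure.map_add _ _ BorelSquare.measurable_snd, Measure.map_smul, Measure.map_smul]
    rfl

/-- Mixing near-optimal couplings couples the mixtures, and the cost is linear in the coupling.
Finiteness leaves room for the error `ε`, which survives with total weight one. -/
theorem transportCost_convMeasure_le (r : unitInterval) {μ μ' ν ν' : Measure X}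
    (h : transportCost p μ ν ≠ ∞) (h' : transportCost p μ' ν' ≠ ∞) :
    transportCost p (convMeasure r μ μ') (convMeasure r ν ν') ≤
      ENNReal.ofReal r * transportCost p μ ν + ENNReal.ofReal (1 - r) * transportCost p μ' ν' := by
  have hr : ENNReal.ofReal r + ENNReal.ofReal (1 - r) = 1 := by
    rw [← ENNReal.ofReal_add r.2.1 (by linarith [r.2.2])]
    simp
  refine ENNReal.le_of_forall_pos_le_add fun ε hε _ => ?_
  have hε' : (ε : ℝ≥0∞) ≠ 0 := by simpa using hε.ne'
  obtain ⟨γ, hγ, hlt⟩ := exists_couples_lt (ENNReal.lt_add_right h hε')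
  obtain ⟨γ', hγ', hlt'⟩ := exists_couples_lt (ENNReal.lt_add_right h' hε')
  refine (transportCost_le_of_couples (hγ.smul_add_smul hγ' r)).trans ?_
  rw [lintegral_add_measure, lintegral_smul_measure, lintegral_smul_measure, smul_eq_mul,
    smul_eq_mul]
  calc _ ≤ ENNReal.ofReal r * (transportCost p μ ν + ε) +
        ENNReal.ofReal (1 - r) * (transportCost p μ' ν' + ε) := by gcongr
    _ = ENNReal.ofReal r * transportCost p μ ν + ENNReal.ofReal (1 - r) * transportCost p μ' ν' +
        (ENNReal.ofReal r + ENNReal.ofReal (1 - r)) * ε := by ring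
    _ = _ := by rw [hr, one_mul]

/-! ### Gluing in a nonseparable space, and the triangle inequality. -/

section Gluing

variable {Ω : Type*} [MeasurableSpace Ω]

/-- The `L^p` distance of two functions with values in a metric space. -/
def lpDist (p : ℝ) (P : Measure Ω) {E : Type*} [MetricSpace E] (Y Z : Ω → E) : ℝ≥0∞ :=
  (∫⁻ ω, edist (Y ω) (Z ω) ^ p ∂P) ^ (1 / p)

variable {E : Type*} [MetricSpace E] [SecondCountableTopology E] [MeasurableSpace E] [BorelSpace E]

theorem lpDist_triangle (hp : 1 ≤ p) (P : Measure Ω) {Y Z W : Ω → E} (hY : Measurable Y)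
    (hZ : Measurable Z) (hW : Measurable W) :
    lpDist p P Y W ≤ lpDist p P Y Z + lpDist p P Z W := by
  have hp0 : 0 ≤ p := by linarith
  refine le_trans (ENNReal.rpow_le_rpow (lintegral_mono fun ω => ?_) (by positivity))
    (ENNReal.lintegral_Lp_add_le (hY.edist hZ).aemeasurable (hZ.edist hW).aemeasurable hp)
  exact ENNReal.rpow_le_rpow (edist_triangle _ _ _) hp0

theorem lintegral_edist_le_lpDist (hp : 1 ≤ p) (P : Measure Ω) [IsProbabilityMeasure P]
    {Y Z : Ω → E} (hY : Measurable Y) (hZ : Measurable Z) :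
    ∫⁻ ω, edist (Y ω) (Z ω) ∂P ≤ lpDist p P Y Z := by
  have := eLpNorm'_le_eLpNorm'_of_exponent_le one_pos hp P
    (f := fun ω => edist (Y ω) (Z ω)) (hY.edist hZ).aestronglyMeasurable
  simpa [eLpNorm', lpDist] using this

/-- Countably many couplings between consecutive terms of a sequence of Radon measures can be
realized by a sequence of random variables. -/
theorem exists_gluing [CompleteSpace X] (p : ℝ) (μ : ℕ → Measure X)
    [∀ n, IsProbabilityMeasure (μ n)] (hμ : ∀ n, (μ n).InnerRegular)
    (γ : ℕ → Measure (BorelSquare X)) (hγ : ∀ n, Couples (γ n) (μ n) (μ (n + 1))) :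
    ∃ S : Set X, IsClosed S ∧ TopologicalSpace.IsSeparable S ∧
      ∃ P : Measure (ℕ → S), IsProbabilityMeasure P ∧
        (∀ n, P.map (fun x => (x n : X)) = μ n) ∧
        ∀ n, ∫⁻ x, edist (x n) (x (n + 1)) ^ p ∂P = ∫⁻ z, edist z.fst z.snd ^ p ∂γ n := by
  obtain ⟨S, hS, hSs, hμS⟩ := exists_isClosed_isSeparable_measure_compl μ hμ
  refine ⟨S, hS, hSs, ?_⟩
  have hne : S.Nonempty := by
    by_contra h
    have := hμS 0
    rw [Set.not_nonempty_iff_eq_empty.1 h, Set.compl_empty, measure_univ] at this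
    exact one_ne_zero this
  have := hne.to_subtype
  have := hSs.secondCountableTopology
  have : CompleteSpace S := hS.completeSpace_coe
  -- A measurable retraction onto `S` moves the couplings to `S × S`, where `S` is Polish. It is the
  -- identity almost everywhere for every `μ n`, so neither marginals nor costs change.
  obtain ⟨ρ, hρ, hρS⟩ := hS.measurableSet.exists_measurable_proj hne
  have hρae (n : ℕ) : ∀ᵐ x ∂μ n, (ρ x : X) = x := by
    have : ∀ᵐ x ∂μ n, x ∈ S := hμS n
    filter_upwards [this] with x hx
    rw [hρS ⟨x, hx⟩]
  have hμρ (n : ℕ) : (μ n).map (fun x => (ρ x : X)) = μ n := by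
    conv_rhs => rw [← Measure.map_id (μ := μ n)]
    exact Measure.map_congr (hρae n)
  let R (z : BorelSquare X) : S × S := (ρ z.fst, ρ z.snd)
  have hR : Measurable R :=
    (hρ.comp BorelSquare.measurable_fst).prodMk (hρ.comp BorelSquare.measurable_snd)
  have hγP (n : ℕ) : IsProbabilityMeasure (γ n) := (couples_iff.1 (hγ n)).1
  have hfst (n : ℕ) : (γ n).map BorelSquare.fst = μ n := (couples_iff.1 (hγ n)).2.1
  have hsnd (n : ℕ) : (γ n).map BorelSquare.snd = μ (n + 1) := (couples_iff.1 (hγ n)).2.2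
  have hR1 (n : ℕ) : ((γ n).map R).fst = (μ n).map ρ := by
    rw [← hfst n, Measure.fst, Measure.map_map (by fun_prop) hR,
      Measure.map_map hρ BorelSquare.measurable_fst]
    rfl
  have hR2 (n : ℕ) : ((γ n).map R).snd = (μ (n + 1)).map ρ := by
    rw [← hsnd n, Measure.snd, Measure.map_map (by fun_prop) hR,
      Measure.map_map hρ BorelSquare.measurable_snd]
    rfl
  have (n : ℕ) : IsProbabilityMeasure ((γ n).map R) :=
    Measure.isProbabilityMeasure_map hR.aemeasurable
  obtain ⟨P, hP, h⟩ := exists_measure_map_eval_eq (fun n => (γ n).map R)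
    fun n => (hR2 n).trans (hR1 (n + 1)).symm
  refine ⟨P, hP, fun n => ?_, fun n => ?_⟩
  · have h1 : P.map (fun x => x n) = (μ n).map ρ := by
      rw [← hR1 n, ← h n, Measure.fst, Measure.map_map (by fun_prop) (by fun_prop)]
      rfl
    rw [← hμρ n]
    have h2 := congrArg (Measure.map (Subtype.val : S → X)) h1
    rwa [Measure.map_map measurable_subtype_coe (by fun_prop),
      Measure.map_map measurable_subtype_coe hρ] at h2
  · have hm : Measurable fun z : S × S => edist z.1 z.2 ^ p := measurable_edist.pow_const p
    have h1 : ∫⁻ x, edist (x n) (x (n + 1)) ^ p ∂P = ∫⁻ z, edist z.1 z.2 ^ p ∂((γ n).map R) := by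
      rw [← h n, lintegral_map hm (by fun_prop)]
    rw [h1, lintegral_map hm hR]
    have a1 : ∀ᵐ z ∂γ n, (ρ z.fst : X) = z.fst :=
      ae_of_ae_map BorelSquare.measurable_fst.aemeasurable (by rw [hfst n]; exact hρae n)
    have a2 : ∀ᵐ z ∂γ n, (ρ z.snd : X) = z.snd :=
      ae_of_ae_map BorelSquare.measurable_snd.aemeasurable (by rw [hsnd n]; exact hρae (n + 1))
    refine lintegral_congr_ae ?_
    filter_upwards [a1, a2] with z h1 h2
    simp only [R, Subtype.edist_eq, h1, h2]

theorem wassersteinDist_map_le (hp : 0 < p) (P : Measure Ω) [IsProbabilityMeasure P] {S : Set X}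
    (hS : TopologicalSpace.IsSeparable S) {Y Z : Ω → S} (hY : Measurable Y) (hZ : Measurable Z) :
    wassersteinDist p (P.map fun ω => (Y ω : X)) (P.map fun ω => (Z ω : X)) ≤ lpDist p P Y Z := by
  rw [wassersteinDist_eq]
  exact ENNReal.rpow_le_rpow (transportCost_map_le P (measurable_mk_of_isSeparable hS hY hZ))
    (by positivity)

theorem wassersteinDist_triangle [CompleteSpace X] (hp : 1 ≤ p) {μ ν ξ : Measure X}
    [IsProbabilityMeasure μ] [IsProbabilityMeasure ν] [IsProbabilityMeasure ξ]
    (hμ : μ.InnerRegular) (hν : ν.InnerRegular) (hξ : ξ.InnerRegular) :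
    wassersteinDist p μ ξ ≤ wassersteinDist p μ ν + wassersteinDist p ν ξ := by
  have hp0 : 0 < p := by linarith
  refine ENNReal.le_of_forall_pos_le_add fun ε hε htop => ?_
  have hε' : ((ε / 2 : NNReal) : ℝ≥0∞) ≠ 0 := by simpa using hε.ne'
  rw [ENNReal.add_lt_top] at htop
  obtain ⟨γ, hγ, hlt⟩ := exists_couples_rpow_lt hp0 (ENNReal.lt_add_right htop.1.ne hε')
  obtain ⟨γ', hγ', hlt'⟩ := exists_couples_rpow_lt hp0 (ENNReal.lt_add_right htop.2.ne hε')
  -- `exists_gluing` takes an infinite sequence, so `μ, ν, ξ` is continued by `ξ` forever, with some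
  -- coupling of `ξ` with itself.
  obtain ⟨γ'', hγ'', -⟩ := exists_couples_lt
    (show transportCost p ξ ξ < 1 by rw [transportCost_self hp0]; exact one_pos)
  let m : ℕ → Measure X := fun n => match n with
    | 0 => μ
    | 1 => ν
    | _ + 2 => ξ
  let g : ℕ → Measure (BorelSquare X) := fun n => match n with
    | 0 => γ
    | 1 => γ'
    | _ + 2 => γ''
  have (n : ℕ) : IsProbabilityMeasure (m n) := by
    match n with
    | 0 => assumption
    | 1 => assumption
    | _ + 2 => assumption
  obtain ⟨S, -, hS, P, hP, hmap, hcost⟩ := exists_gluing p m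
    (fun n => match n with
      | 0 => hμ
      | 1 => hν
      | _ + 2 => hξ) g
    (fun n => match n with
      | 0 => hγ
      | 1 => hγ'
      | _ + 2 => hγ'')
  have := hS.secondCountableTopology
  have h0 : P.map (fun x => (x 0 : X)) = μ := hmap 0
  have h2 : P.map (fun x => (x 2 : X)) = ξ := hmap 2
  have h01 : lpDist p P (fun x => x 0) (fun x => x 1) <
      wassersteinDist p μ ν + (ε / 2 : NNReal) := by
    rw [lpDist, hcost 0]
    exact hlt
  have h12 : lpDist p P (fun x => x 1) (fun x => x 2) <
      wassersteinDist p ν ξ + (ε / 2 : NNReal) := by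
    rw [lpDist, hcost 1]
    exact hlt'
  calc wassersteinDist p μ ξ ≤ lpDist p P (fun x => x 0) (fun x => x 2) := by
        rw [← h0, ← h2]
        exact wassersteinDist_map_le hp0 P hS (measurable_pi_apply 0) (measurable_pi_apply 2)
    _ ≤ lpDist p P (fun x => x 0) (fun x => x 1) + lpDist p P (fun x => x 1) (fun x => x 2) :=
        lpDist_triangle hp P (measurable_pi_apply 0) (measurable_pi_apply 1) (measurable_pi_apply 2)
    _ ≤ (wassersteinDist p μ ν + (ε / 2 : NNReal)) + (wassersteinDist p ν ξ + (ε / 2 : NNReal)) :=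
        add_le_add h01.le h12.le
    _ = wassersteinDist p μ ν + wassersteinDist p ν ξ + ((ε / 2 : NNReal) + (ε / 2 : NNReal)) := by
        ring
    _ = _ := by rw [← ENNReal.coe_add, add_halves]

end Gluing

end Metric

/-! ### `L^p` limits of random variables. -/

section Completeness

open Filter Topology

variable {Ω : Type*} [MeasurableSpace Ω] {p : ℝ}
  {E : Type*} [MetricSpace E] [SecondCountableTopology E] [MeasurableSpace E] [BorelSpace E]

theorem two_mul_inv_two_pow_succ (n : ℕ) : 2 * (2⁻¹ : ℝ≥0∞) ^ (n + 1) = 2⁻¹ ^ n := by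
  rw [pow_succ', ← mul_assoc, ENNReal.mul_inv_cancel two_ne_zero ENNReal.ofNat_ne_top, one_mul]

/-- Keeping the remaining geometric tail on the left makes the induction on `k` close: each step
spends half of the tail. -/
theorem lpDist_add_le (hp : 1 ≤ p) (P : Measure Ω) {Y : ℕ → Ω → E} (hY : ∀ n, Measurable (Y n))
    (h : ∀ n, lpDist p P (Y n) (Y (n + 1)) ≤ 2⁻¹ ^ n) (n k : ℕ) :
    lpDist p P (Y n) (Y (n + k)) + 2 * 2⁻¹ ^ (n + k) ≤ 2 * 2⁻¹ ^ n := by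
  have hp0 : 0 < p := by linarith
  induction k with
  | zero => simp [lpDist, hp0]
  | succ k ih =>
    calc lpDist p P (Y n) (Y (n + (k + 1))) + 2 * 2⁻¹ ^ (n + (k + 1))
        ≤ lpDist p P (Y n) (Y (n + k)) + 2⁻¹ ^ (n + k) + 2⁻¹ ^ (n + k) := by
          rw [← add_assoc n k 1, two_mul_inv_two_pow_succ]
          gcongr
          exact (lpDist_triangle hp P (hY _) (hY (n + k)) (hY _)).trans
            (add_le_add_right (h (n + k)) _)
      _ = lpDist p P (Y n) (Y (n + k)) + 2 * 2⁻¹ ^ (n + k) := by ring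
      _ ≤ _ := ih

/-- A rapidly `L^p`-Cauchy sequence of random variables has an `L^p`-limit. -/
theorem exists_lpDist_le [CompleteSpace E] [Nonempty E] (hp : 1 ≤ p) (P : Measure Ω)
    [IsProbabilityMeasure P] {Y : ℕ → Ω → E} (hY : ∀ n, Measurable (Y n))
    (h : ∀ n, lpDist p P (Y n) (Y (n + 1)) ≤ 2⁻¹ ^ n) :
    ∃ Z : Ω → E, Measurable Z ∧ ∀ n, lpDist p P (Y n) Z ≤ 2 * 2⁻¹ ^ n := by
  have hp0 : 0 < p := by linarith
  have hm (n m : ℕ) : Measurable fun ω => edist (Y n ω) (Y m ω) := (hY n).edist (hY m)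
  -- On a probability space the `L^1` distance is at most the `L^p` distance, so consecutive
  -- distances have summable expectations and almost every path is Cauchy.
  have hsum : ∫⁻ ω, ∑' n, edist (Y n ω) (Y (n + 1) ω) ∂P ≠ ∞ := by
    rw [lintegral_tsum fun n => (hm n (n + 1)).aemeasurable]
    refine ne_top_of_le_ne_top (b := ∑' n : ℕ, (2⁻¹ : ℝ≥0∞) ^ n) ?_ (ENNReal.tsum_le_tsum fun n =>
      (lintegral_edist_le_lpDist hp P (hY n) (hY (n + 1))).trans (h n))
    rw [ENNReal.tsum_geometric, ENNReal.one_sub_inv_two, inv_inv]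
    exact ENNReal.ofNat_ne_top
  have hconv : ∀ᵐ ω ∂P, ∃ l, Tendsto (fun n => Y n ω) atTop (𝓝 l) := by
    filter_upwards [ae_lt_top (Measurable.tsum fun n => hm n (n + 1)) hsum] with ω hω
    exact cauchySeq_tendsto_of_complete
      (cauchySeq_of_edist_le_of_tsum_ne_top _ (fun n => le_rfl) hω.ne)
  obtain ⟨Z, hZ, hlim⟩ := measurable_limit_of_tendsto_metrizable_ae
    (fun n => (hY n).aemeasurable) hconv
  refine ⟨Z, hZ, fun n => ?_⟩
  have hae : ∀ᵐ ω ∂P, edist (Y n ω) (Z ω) ^ p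
      = liminf (fun k => edist (Y n ω) (Y (n + k) ω) ^ p) atTop := by
    filter_upwards [hlim] with ω hω
    have h1 : Tendsto (fun k => Y (n + k) ω) atTop (𝓝 (Z ω)) := by
      simp only [add_comm n]
      exact hω.comp (tendsto_add_atTop_nat n)
    exact ((ENNReal.continuous_rpow_const.tendsto _).comp
      (tendsto_const_nhds.edist h1)).liminf_eq.symm
  rw [lpDist, one_div, ENNReal.rpow_inv_le_iff hp0, lintegral_congr_ae hae]
  -- Fatou's lemma carries the bound uniform in `k` over to the limit.
  refine (lintegral_liminf_le fun k => (hm n (n + k)).pow_const p).trans ?_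
  refine liminf_le_of_le (h := fun b hb => ?_)
  obtain ⟨k, hk⟩ := hb.exists
  refine hk.trans ?_
  rw [← ENNReal.rpow_inv_le_iff hp0, ← one_div]
  exact le_self_add.trans (lpDist_add_le hp P hY h n k)

end Completeness

/-! ### `P_p(X)` as a complete Wasserstein algebra. -/

namespace Pp

variable {p : ℝ} [hp : Fact (1 ≤ p)] {X : Type*} [MetricSpace X] [CompleteSpace X]
  [MeasurableSpace X] [BorelSpace X]

attribute [instance] Pp.isProbabilityMeasure

/-- `Pp p X` with the Wasserstein distance as an extended metric space. -/
scoped instance emetricSpace : EMetricSpace (Pp p X) where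
  edist μ ν := wassersteinDist p μ.toMeasure ν.toMeasure
  edist_self μ := by
    have hp0 : 0 < p := zero_lt_one.trans_le hp.out
    rw [wassersteinDist_eq, transportCost_self hp0, ENNReal.zero_rpow_of_pos (by positivity)]
  edist_comm μ ν := by rw [wassersteinDist_eq, wassersteinDist_eq, transportCost_comm]
  edist_triangle μ ν ξ := wassersteinDist_triangle hp.out μ.radon ν.radon ξ.radon
  eq_of_edist_eq_zero {μ ν} h := by
    have hp0 : 0 < p := zero_lt_one.trans_le hp.out
    rw [wassersteinDist_eq, ENNReal.rpow_eq_zero_iff_of_pos (by positivity)] at h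
    exact Pp.ext (eq_of_transportCost_eq_zero hp0 h)

theorem edist_eq (μ ν : Pp p X) : edist μ ν = wassersteinDist p μ.toMeasure ν.toMeasure := rfl

theorem edist_rpow (μ ν : Pp p X) :
    edist μ ν ^ p = transportCost p μ.toMeasure ν.toMeasure := by
  have hp0 : p ≠ 0 := (zero_lt_one.trans_le hp.out).ne'
  rw [edist_eq, wassersteinDist_eq, ← ENNReal.rpow_mul, one_div_mul_cancel hp0, ENNReal.rpow_one]

theorem edist_dirac_lt_top (μ : Pp p X) (x : X) : edist μ (dirac p x) < ∞ := by
  have hp0 : 0 < p := zero_lt_one.trans_le hp.out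
  rw [edist_eq, wassersteinDist_eq]
  exact ENNReal.rpow_lt_top_of_nonneg (by positivity)
    ((transportCost_dirac_le μ.toMeasure x).trans_lt (μ.hasFiniteMoment.all x)).ne

/-- `Pp p X` with the Wasserstein distance as a metric space. -/
scoped instance metricSpace : MetricSpace (Pp p X) :=
  EMetricSpace.toMetricSpace fun μ ν => by
    obtain ⟨x, -⟩ := μ.hasFiniteMoment
    refine ((edist_triangle μ (dirac p x) ν).trans_lt (ENNReal.add_lt_top.2
      ⟨edist_dirac_lt_top μ x, ?_⟩)).ne
    rw [edist_comm]
    exact edist_dirac_lt_top ν x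

theorem isWassersteinAlgebra : IsWassersteinAlgebra p (Pp p X) := by
  have hp0 : 0 < p := zero_lt_one.trans_le hp.out
  have key (r : unitInterval) (x x' y y' : Pp p X) :
      edist (BarycentricAlgebra.conv r x y) (BarycentricAlgebra.conv r x' y') ^ p ≤
        ENNReal.ofReal r * edist x x' ^ p + ENNReal.ofReal (1 - r) * edist y y' ^ p := by
    have h (a b : Pp p X) : transportCost p a.toMeasure b.toMeasure ≠ ∞ := by
      rw [← edist_rpow]
      exact ENNReal.rpow_ne_top_of_nonneg hp0.le (edist_ne_top a b)
    simp only [edist_rpow]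
    exact transportCost_convMeasure_le r (h _ _) (h _ _)
  have hw (r : unitInterval) (x x' y y' : Pp p X) :
      dist (BarycentricAlgebra.conv r x y) (BarycentricAlgebra.conv r x' y') ^ p
        ≤ (r : ℝ) * dist x x' ^ p + (1 - (r : ℝ)) * dist y y' ^ p := by
    have hr : 0 ≤ 1 - (r : ℝ) := by linarith [r.2.2]
    have h := key r x x' y y'
    simp only [edist_dist, ENNReal.ofReal_rpow_of_nonneg dist_nonneg hp0.le] at h
    rw [← ENNReal.ofReal_mul r.2.1, ← ENNReal.ofReal_mul hr, ← ENNReal.ofReal_add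
      (mul_nonneg r.2.1 (by positivity)) (by positivity), ENNReal.ofReal_le_ofReal_iff] at h
    · exact h
    · have := r.2.1
      positivity
  -- Nonexpansiveness follows from the Wasserstein condition by bounding both distances by their
  -- maximum.
  refine ⟨fun r => LipschitzWith.of_dist_le_mul fun z z' => ?_, hw⟩
  rw [NNReal.coe_one, one_mul, ← Real.rpow_le_rpow_iff dist_nonneg dist_nonneg hp0]
  refine (hw r _ _ _ _).trans ?_
  have hr : 0 ≤ 1 - (r : ℝ) := by linarith [r.2.2]
  have h1 : dist z.1 z'.1 ^ p ≤ dist z z' ^ p :=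
    Real.rpow_le_rpow dist_nonneg (le_max_left _ _) hp0.le
  have h2 : dist z.2 z'.2 ^ p ≤ dist z z' ^ p :=
    Real.rpow_le_rpow dist_nonneg (le_max_right _ _) hp0.le
  nlinarith [mul_le_mul_of_nonneg_left h1 r.2.1, mul_le_mul_of_nonneg_left h2 hr]

theorem lipschitzWith_dirac : LipschitzWith 1 (dirac p : X → Pp p X) := by
  have hp0 : 0 < p := zero_lt_one.trans_le hp.out
  intro x y
  rw [ENNReal.coe_one, one_mul, ← ENNReal.rpow_le_rpow_iff hp0, edist_rpow, edist_comm]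
  exact (transportCost_dirac_le _ y).trans_eq (lintegral_dirac _ _)

theorem completeSpace : CompleteSpace (Pp p X) := by
  have hp1 := hp.out
  have hp0 : 0 < p := zero_lt_one.trans_le hp1
  -- Only sequences with consecutive distances below `2⁻¹ ^ n` need a limit; their couplings are
  -- glued into one sequence of random variables, and the law of its `L^p` limit is the candidate.
  refine EMetric.complete_of_convergent_controlled_sequences (fun n => 2⁻¹ ^ n)
    (fun n => ENNReal.pow_pos (by simp) n) fun u hu => ?_
  choose γ hγ hlt using fun n =>
    exists_couples_rpow_lt hp0 (hu n n (n + 1) le_rfl (Nat.le_succ n))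
  obtain ⟨S, hS, hSs, P, hP, hmap, hcost⟩ := exists_gluing p (fun n => (u n).toMeasure)
    (fun n => (u n).radon) γ hγ
  have := hSs.secondCountableTopology
  have : CompleteSpace S := hS.completeSpace_coe
  have : Nonempty S := by
    obtain ⟨x⟩ : Nonempty (ℕ → S) := P.nonempty_of_neZero
    exact ⟨x 0⟩
  obtain ⟨Z, hZ, hYZ⟩ := exists_lpDist_le hp1 P (Y := fun n x => x n)
    (fun n => measurable_pi_apply n) fun n => by
      rw [lpDist, hcost n]
      exact (hlt n).le
  have hZX : Measurable fun x => (Z x : X) := measurable_subtype_coe.comp hZ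
  obtain ⟨s₀⟩ := ‹Nonempty S›
  let ν : Pp p X :=
    { toMeasure := P.map fun x => (Z x : X)
      isProbabilityMeasure := Measure.isProbabilityMeasure_map hZX.aemeasurable
      radon := by
        -- The law on the Polish space `S` is inner regular, and this passes to its continuous image
        -- in `X`.
        have : IsProbabilityMeasure (P.map Z) := Measure.isProbabilityMeasure_map hZ.aemeasurable
        have h := Measure.InnerRegular.map_of_continuous (μ := P.map Z)
          (f := (Subtype.val : S → X)) continuous_subtype_val
        rwa [Measure.map_map measurable_subtype_coe hZ] at h
      hasFiniteMoment := by
        refine ⟨s₀, ?_⟩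
        have hm : Measurable fun x : X => edist (s₀ : X) x ^ p :=
          measurable_edist_right.pow_const p
        have h0 : ∫⁻ x, edist s₀ (x 0) ^ p ∂P < ∞ := by
          have := (u 0).hasFiniteMoment.all (s₀ : X)
          rwa [← hmap 0, lintegral_map hm (by fun_prop)] at this
        have h1 : lpDist p P (fun _ => s₀) Z < ∞ :=
          (lpDist_triangle hp1 P measurable_const (measurable_pi_apply 0) hZ).trans_lt
            (ENNReal.add_lt_top.2 ⟨ENNReal.rpow_lt_top_of_nonneg (by positivity) h0.ne,
              (hYZ 0).trans_lt (by simp)⟩)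
        rw [lintegral_map hm hZX]
        exact (ENNReal.rpow_lt_top_iff_of_pos (by positivity)).1 h1 }
  refine ⟨ν, tendsto_iff_edist_tendsto_0.2 ?_⟩
  have hlim : Filter.Tendsto (fun n : ℕ => 2 * (2⁻¹ : ℝ≥0∞) ^ n) Filter.atTop (nhds 0) := by
    have := ENNReal.Tendsto.const_mul (a := 2) (ENNReal.tendsto_pow_atTop_nhds_zero_of_lt_one
      (r := 2⁻¹) (by simp)) (Or.inr ENNReal.ofNat_ne_top)
    rwa [mul_zero] at this
  refine tendsto_of_tendsto_of_tendsto_of_le_of_le tendsto_const_nhds hlim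
    (fun n => zero_le) fun n => le_trans ?_ (hYZ n)
  change wassersteinDist p _ _ ≤ _
  rw [← hmap n]
  exact wassersteinDist_map_le hp0 P hSs (measurable_pi_apply n) hZ

end Pp

/-! ### Finitely supported measures. -/

section FiniteSupport

variable {Ω : Type*} [MeasurableSpace Ω]

theorem measure_compl_eq_zero_of_subset {μ : Measure Ω} {s t : Finset Ω} (hst : s ⊆ t)
    (hs : μ (s : Set Ω)ᶜ = 0) : μ (t : Set Ω)ᶜ = 0 :=
  measure_mono_null (Set.compl_subset_compl.2 (Finset.coe_subset.2 hst)) hs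

theorem convMeasure_eq_zero (r : unitInterval) {μ ν : Measure Ω} {U : Set Ω} (hμ : μ U = 0)
    (hν : ν U = 0) : convMeasure r μ ν U = 0 := by
  simp only [convMeasure, Measure.coe_add, Measure.coe_smul, Pi.add_apply, Pi.smul_apply, hμ,
    hν, smul_zero, add_zero]

theorem innerRegular_of_measure_compl [TopologicalSpace Ω] {μ : Measure Ω} {s : Finset Ω}
    (hs : μ (s : Set Ω)ᶜ = 0) : μ.InnerRegular := by
  refine ⟨fun U _ r hr => ⟨U ∩ s, Set.inter_subset_left, ?_, ?_⟩⟩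
  · exact (s.finite_toSet.inter_of_right U).isCompact
  · rwa [measure_inter_conull hs]

variable [MeasurableSingletonClass Ω]

theorem lintegral_eq_sum_of_measure_compl {μ : Measure Ω} {s : Finset Ω}
    (hs : μ (s : Set Ω)ᶜ = 0) (g : Ω → ℝ≥0∞) : ∫⁻ x, g x ∂μ = ∑ x ∈ s, g x * μ {x} := by
  have h : ∀ᵐ x ∂μ, x ∈ (s : Set Ω) := hs
  rw [← lintegral_finset, Measure.restrict_eq_self_of_ae_mem h]

theorem measure_eq_sum_filter {μ : Measure Ω} {s : Finset Ω} (hs : μ (s : Set Ω)ᶜ = 0)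
    {U : Set Ω} (hU : MeasurableSet U) [DecidablePred (· ∈ U)] :
    μ U = ∑ x ∈ s with x ∈ U, μ {x} := by
  rw [← lintegral_indicator_one hU, lintegral_eq_sum_of_measure_compl hs, Finset.sum_filter]
  refine Finset.sum_congr rfl fun x _ => ?_
  by_cases hx : x ∈ U <;> simp [hx]

theorem sum_smul_dirac_eq {μ : Measure Ω} [IsFiniteMeasure μ] {s : Finset Ω}
    (hs : μ (s : Set Ω)ᶜ = 0) : ∑ x ∈ s, (μ {x}).toNNReal • Measure.dirac x = μ := by
  classical
  ext U hU
  rw [measure_eq_sum_filter hs hU, Finset.sum_filter, Measure.finsetSum_apply]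
  refine Finset.sum_congr rfl fun x _ => ?_
  rw [Measure.smul_apply, Measure.dirac_apply' _ hU, ENNReal.smul_def,
    ENNReal.coe_toNNReal (measure_ne_top _ _)]
  by_cases hx : x ∈ U <;> simp [hx]

theorem sum_toNNReal_measure_singleton {μ : Measure Ω} [IsProbabilityMeasure μ] {s : Finset Ω}
    (hs : μ (s : Set Ω)ᶜ = 0) : ∑ x ∈ s, (μ {x}).toNNReal = 1 := by
  rw [← ENNReal.toNNReal_sum fun x _ => measure_ne_top _ _, sum_measure_singleton,
    (prob_compl_eq_zero_iff s.measurableSet).1 hs, ENNReal.toNNReal_one]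

end FiniteSupport

/-! ### Barycenters of finitely supported measures. -/

section Barycenter

open Cone

open scoped NNReal

variable {X B : Type*} [MeasurableSpace X] [BarycentricAlgebra B]

/-- The barycenter of the image under `f` of a finitely supported measure, as a point of the
cone. -/
def barycenter (f : X → B) (μ : Measure X) : Cone B :=
  ∑ᶠ x, (μ {x}).toNNReal • ι (f x)

theorem barycenter_eq_sum (f : X → B) {μ : Measure X} {s : Finset X}
    (hs : μ (s : Set X)ᶜ = 0) : barycenter f μ = ∑ x ∈ s, (μ {x}).toNNReal • ι (f x) := by
  refine finsum_eq_sum_of_support_subset _ fun x hx => ?_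
  by_contra hxs
  refine hx ?_
  have : μ {x} = 0 := measure_mono_null (Set.singleton_subset_iff.2 hxs) hs
  simp only [this, ENNReal.toNNReal_zero, zero_smul]

theorem barycenter_convMeasure (f : X → B) {μ ν : Measure X} [IsFiniteMeasure μ]
    [IsFiniteMeasure ν] {s t : Finset X} (hs : μ (s : Set X)ᶜ = 0) (ht : ν (t : Set X)ᶜ = 0)
    (r : unitInterval) :
    barycenter f (convMeasure r μ ν) =
      weight r • barycenter f μ + weight (unitInterval.symm r) • barycenter f ν := by
  classical
  have hs' := measure_compl_eq_zero_of_subset (t := s ∪ t) Finset.subset_union_left hs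
  have ht' := measure_compl_eq_zero_of_subset (t := s ∪ t) Finset.subset_union_right ht
  have hst := convMeasure_eq_zero r hs' ht'
  rw [barycenter_eq_sum f hst, barycenter_eq_sum f hs', barycenter_eq_sum f ht', Finset.smul_sum,
    Finset.smul_sum, ← Finset.sum_add_distrib]
  refine Finset.sum_congr rfl fun x _ => ?_
  rw [smul_smul, smul_smul, ← add_smul]
  congr 1
  have e1 : (ENNReal.ofReal r).toNNReal = weight r := by
    ext; exact Real.coe_toNNReal _ r.2.1
  have e2 : (ENNReal.ofReal (1 - r)).toNNReal = weight (unitInterval.symm r) := by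
    ext; exact Real.coe_toNNReal _ (unitInterval.symm r).2.1
  simp only [convMeasure, Measure.coe_add, Measure.coe_smul, Pi.add_apply, Pi.smul_apply,
    smul_eq_mul]
  rw [ENNReal.toNNReal_add (ENNReal.mul_ne_top ENNReal.ofReal_ne_top (measure_ne_top _ _))
    (ENNReal.mul_ne_top ENNReal.ofReal_ne_top (measure_ne_top _ _)), ENNReal.toNNReal_mul,
    ENNReal.toNNReal_mul, e1, e2]

variable [MeasurableSingletonClass X]

theorem mass_barycenter (f : X → B) {μ : Measure X} [IsProbabilityMeasure μ] {s : Finset X}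
    (hs : μ (s : Set X)ᶜ = 0) : mass (barycenter f μ) = 1 := by
  rw [barycenter_eq_sum f hs, map_sum]
  simp only [map_smul, mass_ι, smul_eq_mul, mul_one]
  exact sum_toNNReal_measure_singleton hs

/-- Group the sum by the fibers of `Y`. For the two projections of a coupling, this writes both
barycenters over the same index set with the same weights. -/
theorem barycenter_map {Ω : Type*} [MeasurableSpace Ω] [MeasurableSingletonClass Ω] (f : X → B)
    {γ : Measure Ω} [IsFiniteMeasure γ] {q : Finset Ω} (hq : γ (q : Set Ω)ᶜ = 0) {Y : Ω → X}
    (hY : Measurable Y) :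
    barycenter f (γ.map Y) = ∑ z ∈ q, (γ {z}).toNNReal • ι (f (Y z)) := by
  classical
  have hs : γ.map Y ((q.image Y : Finset X) : Set X)ᶜ = 0 := by
    rw [Measure.map_apply hY (Finset.measurableSet _).compl]
    refine measure_mono_null (Set.compl_subset_compl.2 fun z hz => ?_) hq
    exact Finset.mem_coe.2 (Finset.mem_image_of_mem Y hz)
  rw [barycenter_eq_sum f hs,
    ← Finset.sum_fiberwise_of_maps_to (fun z hz => Finset.mem_image_of_mem Y hz)]
  refine Finset.sum_congr rfl fun x _ => ?_
  rw [Measure.map_apply hY (measurableSet_singleton x),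
    measure_eq_sum_filter hq (hY (measurableSet_singleton x)),
    ENNReal.toNNReal_sum fun z _ => measure_ne_top _ _, Finset.sum_smul]
  refine Finset.sum_congr rfl fun z hz => ?_
  have : Y z = x := (Finset.mem_filter.1 hz).2
  rw [this]

end Barycenter

/-! ### Density and the universal property. -/

namespace Pp

open Cone

variable {p : ℝ} [hp : Fact (1 ≤ p)] {X : Type*} [MetricSpace X]
  [MeasurableSpace X] [BorelSpace X]

/-- The finitely supported measures. -/
def finitelySupported (p : ℝ) (X : Type*) [MetricSpace X] [MeasurableSpace X] : Set (Pp p X) :=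
  {μ | ∃ s : Finset X, μ.toMeasure (s : Set X)ᶜ = 0}

theorem dirac_mem_finitelySupported (x : X) : dirac p x ∈ finitelySupported p X :=
  ⟨{x}, by simp [dirac]⟩

theorem conv_mem_finitelySupported (r : unitInterval) {μ ν : Pp p X}
    (hμ : μ ∈ finitelySupported p X) (hν : ν ∈ finitelySupported p X) :
    BarycentricAlgebra.conv r μ ν ∈ finitelySupported p X := by
  classical
  obtain ⟨s, hs⟩ := hμ
  obtain ⟨t, ht⟩ := hν
  exact ⟨s ∪ t, convMeasure_eq_zero r
    (measure_compl_eq_zero_of_subset Finset.subset_union_left hs)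
    (measure_compl_eq_zero_of_subset Finset.subset_union_right ht)⟩

/-- `T` has finitely many values, and for each fixed value the pairing is continuous, so
separability of `X` is not needed. -/
theorem measurable_mk_simpleFunc (T : SimpleFunc X X) :
    Measurable fun x => BorelSquare.mk x (T x) := fun U hU =>
  T.measurableSet_cut (fun x y => BorelSquare.mk x y ∈ U) fun y => by
    have h : Continuous fun x : X => BorelSquare.mk x y := continuous_id.prodMk continuous_const
    exact h.measurable hU

theorem preservesConv_toMeasure :
    PreservesConv (toMeasure : Pp p X → Measure X) := by
  intro r μ ν
  have e1 : ENNReal.ofReal r = (weight r : ℝ≥0∞) := ENNReal.ofReal_eq_coe_nnreal r.2.1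
  have e2 : ENNReal.ofReal (1 - r) = (weight (unitInterval.symm r) : ℝ≥0∞) :=
    ENNReal.ofReal_eq_coe_nnreal (unitInterval.symm r).2.1
  change convMeasure r μ.toMeasure ν.toMeasure = _
  rw [convMeasure, e1, e2]
  rfl

/-- The combination of Dirac measures is formed in the cone over `Pp p X`. Lifting `toMeasure`
identifies it with `μ`, and lifting `h` evaluates it; this forces uniqueness. -/
theorem ι_apply_eq_barycenter {B : Type*} [BarycentricAlgebra B] {h : Pp p X → B}
    (hh : IsAffine h) {μ : Pp p X} (hμ : μ ∈ finitelySupported p X) :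
    ι (h μ) = barycenter (fun x => h (dirac p x)) μ.toMeasure := by
  obtain ⟨s, hs⟩ := hμ
  have := μ.isProbabilityMeasure
  obtain ⟨μ', hμ'⟩ := exists_ι_eq (u := ∑ x ∈ s, (μ.toMeasure {x}).toNNReal • ι (dirac p x)) (by
    rw [map_sum]
    simp only [map_smul, mass_ι, smul_eq_mul, mul_one]
    exact sum_toNNReal_measure_singleton hs)
  have h1 := congrArg (lift toMeasure preservesConv_toMeasure) hμ'
  simp only [lift_ι, map_sum, map_smul] at h1
  have h2 : μ' = μ := Pp.ext (h1.trans (sum_smul_dirac_eq hs))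
  subst h2
  have h3 := congrArg (lift (fun ν => ι (h ν)) (isAffine_iff_preservesConv.1 hh)) hμ'
  simp only [lift_ι, map_sum, map_smul] at h3
  rw [barycenter_eq_sum _ hs, h3]

variable [CompleteSpace X]

/-- Round each point by a simple function `T n`. The coupling of `x` with `T n x` has cost tending
to zero by dominated convergence: the approximation is never farther from `x` than `x₀`, so the
moment dominates. -/
theorem dense_finitelySupported : Dense (finitelySupported p X) := by
  have hp0 : 0 < p := zero_lt_one.trans_le hp.out
  intro μ
  rw [EMetric.mem_closure_iff]
  intro ε hε
  obtain ⟨S, -, hSs, hμS⟩ := exists_isClosed_isSeparable_measure_compl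
    (fun _ : Unit => μ.toMeasure) fun _ => μ.radon
  have hae : ∀ᵐ x ∂μ.toMeasure, x ∈ S := hμS ()
  obtain ⟨x₀, hx₀⟩ := hae.exists
  have := hSs.separableSpace
  let T (n : ℕ) : SimpleFunc X X := SimpleFunc.approxOn id measurable_id S x₀ hx₀ n
  have hm (n : ℕ) : Measurable fun x => edist x (T n x) ^ p :=
    (BorelSquare.measurable_edist_rpow p).comp (measurable_mk_simpleFunc (T n))
  have hlim := tendsto_lintegral_of_dominated_convergence (μ := μ.toMeasure)
    (F := fun n x => edist x (T n x) ^ p) (f := fun _ => 0) (fun x => edist x₀ x ^ p) hm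
    (fun n => Filter.Eventually.of_forall fun x => ENNReal.rpow_le_rpow
      (by rw [edist_comm]; exact SimpleFunc.edist_approxOn_le measurable_id hx₀ x n) hp0.le)
    (μ.hasFiniteMoment.all x₀).ne (by
      filter_upwards [hae] with x hx
      have h1 : Filter.Tendsto (fun n => T n x) Filter.atTop (nhds x) :=
        SimpleFunc.tendsto_approxOn measurable_id hx₀ (subset_closure hx)
      have h2 := (ENNReal.continuous_rpow_const (y := p)).tendsto _ |>.comp
        (tendsto_const_nhds (x := x) |>.edist h1)
      simpa [Function.comp_def, hp0] using h2)
  rw [lintegral_zero] at hlim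
  have hε' : 0 < ε ^ p := pos_iff_ne_zero.2 fun h0 =>
    hε.ne' ((ENNReal.rpow_eq_zero_iff_of_pos hp0).1 h0)
  obtain ⟨n, hn⟩ := (hlim.eventually (gt_mem_nhds hε')).exists
  have hs : μ.toMeasure.map (T n) ((T n).range : Set X)ᶜ = 0 := by
    rw [Measure.map_apply (T n).measurable (Finset.measurableSet _).compl]
    convert measure_empty (μ := μ.toMeasure)
    ext x
    simp
  have hP : IsProbabilityMeasure (μ.toMeasure.map (T n)) :=
    Measure.isProbabilityMeasure_map (T n).measurable.aemeasurable
  let ν : Pp p X :=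
    { toMeasure := μ.toMeasure.map (T n)
      isProbabilityMeasure := hP
      radon := innerRegular_of_measure_compl hs
      hasFiniteMoment := ⟨x₀, by
        rw [lintegral_eq_sum_of_measure_compl hs]
        exact ENNReal.sum_lt_top.2 fun x _ => ENNReal.mul_lt_top
          (ENNReal.rpow_lt_top_of_nonneg hp0.le (edist_ne_top _ _)) (measure_lt_top _ _)⟩ }
  refine ⟨ν, ⟨(T n).range, hs⟩, ?_⟩
  rw [← ENNReal.rpow_lt_rpow_iff hp0, edist_rpow]
  have hle := transportCost_map_le (p := p) μ.toMeasure (Y := id) (measurable_mk_simpleFunc (T n))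
  rw [Measure.map_id] at hle
  exact hle.trans_lt hn

variable {B : Type*} [MetricSpace B] [BarycentricAlgebra B]

/-- Every coupling is carried by the finite product of the supports, so `costLE_sum` bounds the
`p`-th power of the distance by the transport cost under `f`, hence by the cost in `X`. -/
theorem edist_le_of_ι_eq_barycenter (hB : IsWassersteinAlgebra p B) {f : X → B}
    (hf : LipschitzWith 1 f) {μ ν : Pp p X} (hμ : μ ∈ finitelySupported p X)
    (hν : ν ∈ finitelySupported p X) {a b : B} (ha : ι a = barycenter f μ.toMeasure)
    (hb : ι b = barycenter f ν.toMeasure) : edist a b ≤ edist μ ν := by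
  have hp0 : 0 < p := zero_lt_one.trans_le hp.out
  obtain ⟨s, hs⟩ := hμ
  obtain ⟨t, ht⟩ := hν
  rw [← ENNReal.rpow_le_rpow_iff hp0, edist_rpow]
  refine le_iInf₂ fun γ hγ => ?_
  obtain ⟨hP, h1, h2⟩ := couples_iff.1 hγ
  let q : Finset (BorelSquare X) := (s ×ˢ t : Finset (X × X))
  have hq : γ (q : Set (BorelSquare X))ᶜ = 0 := by
    rw [← h1, Measure.map_apply BorelSquare.measurable_fst s.measurableSet.compl] at hs
    rw [← h2, Measure.map_apply BorelSquare.measurable_snd t.measurableSet.compl] at ht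
    refine measure_mono_null (fun z hz => ?_) (measure_union_null hs ht)
    by_contra h
    simp only [Set.mem_union, Set.mem_preimage, Set.mem_compl_iff, not_or, not_not] at h
    exact hz (Finset.mem_product.2 h)
  rw [← h1, barycenter_map f hq BorelSquare.measurable_fst] at ha
  rw [← h2, barycenter_map f hq BorelSquare.measurable_snd] at hb
  have hcost := costLE_sum hB q (fun z => (γ {z}).toNNReal) (fun z => f z.fst) (fun z => f z.snd)
  rw [← ha, ← hb] at hcost
  have hd := ENNReal.ofReal_le_ofReal (dist_rpow_le_of_costLE hcost)
  rw [← ENNReal.ofReal_rpow_of_nonneg dist_nonneg hp0.le, ← edist_dist] at hd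
  refine hd.trans ?_
  rw [lintegral_eq_sum_of_measure_compl hq, ENNReal.ofReal_sum_of_nonneg fun z _ => by positivity]
  refine Finset.sum_le_sum fun z _ => ?_
  rw [ENNReal.ofReal_mul (NNReal.coe_nonneg _), ENNReal.ofReal_coe_nnreal,
    ENNReal.coe_toNNReal (measure_ne_top _ _), ← ENNReal.ofReal_rpow_of_nonneg dist_nonneg hp0.le,
    ← edist_dist, mul_comm]
  gcongr
  simpa using hf z.fst z.snd

theorem existsUnique_extension [CompleteSpace B] (hB : IsWassersteinAlgebra p B) {f : X → B}
    (hf : LipschitzWith 1 f) :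
    ∃! h : Pp p X → B, LipschitzWith 1 h ∧ IsAffine h ∧ ∀ x, h (dirac p x) = f x := by
  have hd : Dense (finitelySupported p X) := dense_finitelySupported
  have hex (μ : finitelySupported p X) : ∃ b : B, ι b = barycenter f μ.1.toMeasure := by
    obtain ⟨s, hs⟩ := μ.2
    exact exists_ι_eq (mass_barycenter f hs)
  choose h₀ hh₀ using hex
  have hlip : LipschitzWith 1 h₀ := fun μ ν => by
    rw [ENNReal.coe_one, one_mul]
    exact edist_le_of_ι_eq_barycenter hB hf μ.2 ν.2 (hh₀ μ) (hh₀ ν)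
  let h : Pp p X → B := hd.extend h₀
  have hcont : Continuous h := (hd.uniformContinuous_extend hlip.uniformContinuous).continuous
  have hext (μ : finitelySupported p X) : h μ = h₀ μ := hd.extend_eq hlip.continuous μ
  have hr : DenseRange (Subtype.val : finitelySupported p X → Pp p X) := hd.denseRange_val
  refine ⟨h, ⟨fun μ ν => ?_, fun r μ ν => ?_, fun x => ?_⟩, fun h' ⟨h1, h2, h3⟩ => ?_⟩
  · refine hr.induction_on₂ (p := fun μ ν => edist (h μ) (h ν) ≤ (1 : NNReal) * edist μ ν) ?_ ?_ μ ν
    · simp only [ENNReal.coe_one, one_mul]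
      exact isClosed_le (by fun_prop) (by fun_prop)
    · intro μ ν
      rw [hext, hext]
      exact hlip μ ν
  · refine hr.induction_on₂ (p := fun μ ν => h (BarycentricAlgebra.conv r μ ν) =
      BarycentricAlgebra.conv r (h μ) (h ν)) ?_ ?_ μ ν
    · exact isClosed_eq (hcont.comp ((Pp.isWassersteinAlgebra.nonexpansive r).continuous))
        ((hB.nonexpansive r).continuous.comp (hcont.prodMap hcont))
    · intro μ ν
      obtain ⟨s, hs⟩ := μ.2
      obtain ⟨t, ht⟩ := ν.2
      -- In the cone both sides are the barycenter of the same mixture.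
      refine ι_injective ?_
      rw [preservesConv_ι, hext, hext, hh₀, hh₀, ← barycenter_convMeasure f hs ht,
        hext ⟨_, conv_mem_finitelySupported r μ.2 ν.2⟩, hh₀]
      rfl
  · refine ι_injective ?_
    rw [hext ⟨_, dirac_mem_finitelySupported x⟩, hh₀,
      barycenter_eq_sum f (s := {x}) (by simp [dirac])]
    simp [dirac]
  · refine DenseRange.equalizer hr h1.continuous hcont (funext fun μ => ι_injective ?_)
    simp only [Function.comp_apply]
    rw [ι_apply_eq_barycenter h2 μ.2, hext, hh₀]
    simp only [h3]

end Pp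

end WassersteinAlgebra

end

theorem mainTheorem1 (p : ℝ) [Fact (1 ≤ p)] (X : Type u) [MetricSpace X] [CompleteSpace X]
    [MeasurableSpace X] [BorelSpace X] :
    ∃ _ : MetricSpace (WassersteinAlgebra.Pp p X),
      (∀ μ ν : WassersteinAlgebra.Pp p X,
        edist μ ν = WassersteinAlgebra.wassersteinDist p μ.toMeasure ν.toMeasure) ∧
      WassersteinAlgebra.IsFreeCompleteWassersteinAlgebra.{u, u, v} p
        (WassersteinAlgebra.Pp.dirac p : X → WassersteinAlgebra.Pp p X) := by
  let := WassersteinAlgebra.Pp.metricSpace (p := p) (X := X)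
  exact ⟨this, WassersteinAlgebra.Pp.edist_eq,
    { complete := WassersteinAlgebra.Pp.completeSpace
      isWassersteinAlgebra := WassersteinAlgebra.Pp.isWassersteinAlgebra
      nonexpansive := WassersteinAlgebra.Pp.lipschitzWith_dirac
      existsUnique_extension := fun _ _ _ _ hB _ hf =>
        WassersteinAlgebra.Pp.existsUnique_extension hB hf }⟩
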